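/- **Setting.** Robots $r_1,\dots,r_n$ in the Euclidean plane form a chain; $p_i(t)$ is the position of $r_i$ at time $t\ge 0$, $w_i=p_i-p_{i-1}$ for $2\le i\le n$, and for $2\le i\le n-1$, $\alpha_i\in[0,\pi]$ is the angle at $r_i$ between the directions to $r_{i-1}$ and $r_{i+1}$ (so $\alpha_i=\pi$ if $r_i$ lies strictly between its neighbors). Write $\widehat x=x/\|x\|$. A *max-chain* is a configuration with $\|w_i\|=1$ for all $2\le i\le n$ and $w_i=w_{i+1}$ for all $2\le i\le n-1$. **Strategy.** Let $0<\tau\le 1/2$ and $\psi=2\arccos(1-\tau)$. In an execution of Max-MoB with parameter $\tau$ the trajectories $p_i$ are continuous and have right derivatives (velocities) $v_i(t)$ with $\|v_i(t)\|\le 1$ at every $t\ge0$, such that the following holds. * An outer robot moves away from its neighbor along the line joining them: $v_1=-s\,\widehat w_2$. If $\|w_2\|<1$ then $s=1-\tau$; otherwise $r_1$ adjusts its speed in order to stay at distance $1$ from its neighbor, as far as speeds in $[0,1-\tau]$ allow: $s$ is the element of $[0,1-\tau]$ closest to the speed $-\langle v_2,\widehat w_2\rangle$ with which $r_2$ approaches.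 The rule for $r_n$ is symmetric. * An inner robot $r_i$ that is not collinear with its two neighbors moves with speed $1$ along the bisector of the angle at $r_i$ if $\|w_i\|=1$ or $\|w_{i+1}\|=1$ or $\alpha_i<\psi$; otherwise it does not move. * As soon as an inner robot is collinear with its two neighbors, it stays collinear with them, and it moves with speed $1$ towards the midpoint between its neighbors as long as it is not there (that is, $\|v_i\|=1$ and $v_i$ has non-negative inner product with the vector from $p_i$ to the midpoint). Once it has reached the midpoint it stays on the midpoint. **Initial configuration.** Let $n$ be odd and $0<\delta\le\lfloor n/2\rfloor$ (hence $n\ge3$). A *continuous $\delta$-V-configuration* is a configuration with $\|w_i\|=1$ for all $2\le i\le n$, $\alpha_{\lceil n/2\rceil}=\theta:=2\arcsin(\delta/\lfloor n/2\rfloor)$, and $\alpha_i=\pi$ for all other $2\le i\le n-1$. **Theorem.** From every continuous $\delta$-V-configuration at time $0$ there is an execution of Max-MoB with parameter $\tau$, and every such execution is in a max-chain at some time $t$ with $$0\le t\le n\left(\frac1\tau+\frac1{1-\tau}\right).$$ In particular the bound does not depend on $\delta$. -/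

import Mathlib

/-- The Euclidean plane. -/
abbrev Plane : Type := EuclideanSpace ℝ (Fin 2)

namespace RobotChain

noncomputable section

/-! A configuration of the chain of robots `r_1, ..., r_n` is a map `q : ℕ → Plane`, where `q i` is
the position of `r_i` for `1 ≤ i ≤ n`; the values at other indices play no role. -/

/-- The vector `w_i = p_i - p_{i-1}` pointing from robot `r_{i-1}` to robot `r_i`. -/
def link (q : ℕ → Plane) (i : ℕ) : Plane := q i - q (i - 1)

/-- The angle `α_i ∈ [0, π]` at the inner robot `r_i` between the directions to its two neighbors;
it equals `π` when `r_i` lies strictly between its neighbors. -/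
def chainAngle (q : ℕ → Plane) (i : ℕ) : ℝ :=
  EuclideanGeometry.angle (q (i - 1)) (q i) (q (i + 1))

/-- The robot `r_i` and its two neighbors are on a common line. -/
def IsFlatAt (q : ℕ → Plane) (i : ℕ) : Prop :=
  Collinear ℝ {q (i - 1), q i, q (i + 1)}

/-- The midpoint between the two neighbors of `r_i`. -/
def mid (q : ℕ → Plane) (i : ℕ) : Plane := midpoint ℝ (q (i - 1)) (q (i + 1))

/-- The unit vector along the bisector of the angle at `r_i` formed by the vectors pointing from
`r_i` to its two neighbors. -/
def bisectorDir (q : ℕ → Plane) (i : ℕ) : Plane :=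
  NormedSpace.normalize
    (NormedSpace.normalize (q (i - 1) - q i) + NormedSpace.normalize (q (i + 1) - q i))

/-- A max-chain: all link vectors have length one and are equal. -/
def IsMaxChain (n : ℕ) (q : ℕ → Plane) : Prop :=
  (∀ i, 2 ≤ i → i ≤ n → ‖link q i‖ = 1) ∧
    ∀ i, 2 ≤ i → i + 1 ≤ n → link q i = link q (i + 1)

/-- The continuous `δ`-V-configuration (for odd `n`): all links have length one, the angle at the
middle robot `r_⌈n/2⌉` is `θ = 2 arcsin (δ / ⌊n/2⌋)`, and all other angles are `π`. -/
def IsContinuousVConfiguration (n : ℕ) (δ : ℝ) (q : ℕ → Plane) : Prop :=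
  (∀ i, 2 ≤ i → i ≤ n → ‖link q i‖ = 1) ∧
    chainAngle q ((n + 1) / 2) = 2 * Real.arcsin (δ / ((n / 2 : ℕ) : ℝ)) ∧
    ∀ i, 2 ≤ i → i + 1 ≤ n → i ≠ (n + 1) / 2 → chainAngle q i = Real.pi

/-- The threshold angle `ψ = 2 arccos (1 - τ)`. -/
def psi (τ : ℝ) : ℝ := 2 * Real.arccos (1 - τ)

/-- The velocity of an outer robot at `x` whose neighbor is at `y` and has velocity `u`. It points
away from the neighbor. If the distance is less than one, then the speed is `1 - τ`. Otherwise the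
robot tries to keep its distance: among the speeds in `[0, 1 - τ]` it uses the one that is closest
to the speed `⟪u, normalize (x - y)⟫` with which the neighbor approaches. -/
def outerVelocity (τ : ℝ) (x y u : Plane) : Plane :=
  if ‖x - y‖ < 1 then (1 - τ) • NormedSpace.normalize (x - y)
  else max 0 (min (1 - τ) (inner ℝ u (NormedSpace.normalize (x - y)))) •
    NormedSpace.normalize (x - y)

/-- `p` is an execution, during the time `[0, ∞)`, of the strategy Max-MoB with parameter `τ` for
`n` robots, and `v` are its velocities: `p i t` and `v i t` are the position and the velocity (the
right derivative of the position) of the robot `r_i` at time `t`. -/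
structure IsExecution (n : ℕ) (τ : ℝ) (p v : ℕ → ℝ → Plane) : Prop where
  continuousOn : ∀ i, 1 ≤ i → i ≤ n → ContinuousOn (p i) (Set.Ici 0)
  hasVelocity : ∀ i, 1 ≤ i → i ≤ n → ∀ t, 0 ≤ t →
    HasDerivWithinAt (p i) (v i t) (Set.Ici t) t
  speed_le_one : ∀ i, 1 ≤ i → i ≤ n → ∀ t, 0 ≤ t → ‖v i t‖ ≤ 1
  /-- The rule for the two outer robots. -/
  outer_first : ∀ t, 0 ≤ t → v 1 t = outerVelocity τ (p 1 t) (p 2 t) (v 2 t)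
  outer_last : ∀ t, 0 ≤ t → v n t = outerVelocity τ (p n t) (p (n - 1) t) (v (n - 1) t)
  /-- An inner robot that is not collinear with its neighbors moves with speed one along its
  bisector if one of its links has length one or its angle is less than `ψ`. -/
  inner_move : ∀ i, 2 ≤ i → i + 1 ≤ n → ∀ t, 0 ≤ t → ¬ IsFlatAt (p · t) i →
    (‖link (p · t) i‖ = 1 ∨ ‖link (p · t) (i + 1)‖ = 1 ∨ chainAngle (p · t) i < psi τ) →
    v i t = bisectorDir (p · t) i
  /-- Otherwise an inner robot that is not collinear with its neighbors does not move. -/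
  inner_rest : ∀ i, 2 ≤ i → i + 1 ≤ n → ∀ t, 0 ≤ t → ¬ IsFlatAt (p · t) i →
    ¬ (‖link (p · t) i‖ = 1 ∨ ‖link (p · t) (i + 1)‖ = 1 ∨ chainAngle (p · t) i < psi τ) →
    v i t = 0
  /-- As soon as an inner robot is collinear with its neighbors, it ensures to stay collinear. -/
  inner_stay_flat : ∀ i, 2 ≤ i → i + 1 ≤ n → ∀ s t, 0 ≤ s → s ≤ t →
    IsFlatAt (p · s) i → IsFlatAt (p · t) i
  /-- As long as a collinear inner robot is not on the midpoint between its neighbors, it moves with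
  speed one towards the midpoint (up to the motion that keeps it collinear). -/
  inner_to_mid : ∀ i, 2 ≤ i → i + 1 ≤ n → ∀ t, 0 ≤ t → IsFlatAt (p · t) i →
    p i t ≠ mid (p · t) i →
    ‖v i t‖ = 1 ∧ 0 ≤ inner ℝ (v i t) (mid (p · t) i - p i t)
  /-- Once an inner robot is on the midpoint between its neighbors, it stays on the midpoint. -/
  inner_stay_mid : ∀ i, 2 ≤ i → i + 1 ≤ n → ∀ s t, 0 ≤ s → s ≤ t →
    p i s = mid (p · s) i → p i t = mid (p · t) i

/-- `p` is an execution of Max-MoB with parameter `τ` that starts at time `0` in the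
configuration `q`. -/
def IsExecutionFrom (n : ℕ) (τ : ℝ) (q : ℕ → Plane) (p : ℕ → ℝ → Plane) : Prop :=
  (∃ v, IsExecution n τ p v) ∧ ∀ i, 1 ≤ i → i ≤ n → p i 0 = q i

end

end RobotChain

open Set

namespace RobotChain

noncomputable section

/-! ### Monotonicity from right derivatives -/

/-! Write `n = 2 * m + 1`. Every inner robot except the middle one starts on its midpoint and
therefore stays there, so the chain always consists of two straight, equally spaced arms. It is
determined by the middle robot and the vectors `a`, `b` from it to the outer robots. The rule for an
outer robot refers to the velocity of its neighbor, which is itself an affine combination of the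
velocities at both ends of the arm; `eq_outerVelocity_iff` resolves this loop.

The arms keep equal length (`IsArmMotion.norm_eq`). With `L` this length, `H = ‖a + b‖ / 2` and `κ =
H / L` the cosine of half the middle angle, the motion before flatness is a planar system
(`IsArmMotion.isShape`): `L' = s - μκ`, `H' = sκ - μ`, hence `κ' = -μ(1 - κ²)/L`, where `s` and `μ`
are the speeds of the outer robots and the middle robot. So `κ` decreases. While `κ > 1 - τ`, `H`
falls at rate at least `τ`, which lasts at most `m / τ`. Afterwards either `L < m`, the middle robot
rests and `L` grows at rate `1 - τ`, or `L = m`, the length is kept and `κ` falls at rate at least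
`τ / m`. A single potential covers both cases (`IsShape.sub_le_potential`). Together they give `2m/τ
+ m/(1 - τ)`, which is below the claimed bound.

At the first flat time the arms are opposite rather than folded together, because `‖a - b‖` never
decreases. They are taut (`IsShape.taut_of_flat`), because with slack arms and small `κ` the middle
robot would rest and `κ` could not reach zero. The number `δ` matters only through `a 0 ≠ b 0`.

For existence the speeds are discontinuous, so solutions are written down explicitly, phase by
phase, and glued (`IsShapeSolution.concat`). With `κ = -tanh η` the angle equation becomes `η' = μ /
L`, and each phase can be integrated. -/

theorem le_add_of_right_deriv_le {f f' : ℝ → ℝ} {a b c : ℝ} (hab : a ≤ b)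
    (hf : ContinuousOn f (Icc a b))
    (hd : ∀ x ∈ Ico a b, HasDerivWithinAt f (f' x) (Ici x) x)
    (hc : ∀ x ∈ Ico a b, f' x ≤ c) : f b ≤ f a + c * (b - a) := by
  have hB : ∀ x, HasDerivAt (fun x => f a + c * (x - a)) c x := fun x => by
    simpa using (((hasDerivAt_id x).sub_const a).const_mul c).const_add (f a)
  exact image_le_of_deriv_right_le_deriv_boundary (B := fun x => f a + c * (x - a))
    (B' := fun _ => c) hf hd (by simp)
    (fun x _ => (hB x).continuousAt.continuousWithinAt) (fun x _ => (hB x).hasDerivWithinAt) hc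
    (right_mem_Icc.2 hab)

theorem le_of_right_deriv_nonpos {f f' : ℝ → ℝ} {a b : ℝ} (hab : a ≤ b)
    (hf : ContinuousOn f (Icc a b))
    (hd : ∀ x ∈ Ico a b, HasDerivWithinAt f (f' x) (Ici x) x)
    (hc : ∀ x ∈ Ico a b, f' x ≤ 0) : f b ≤ f a := by
  simpa using le_add_of_right_deriv_le hab hf hd hc

theorem le_of_right_deriv_nonneg {f f' : ℝ → ℝ} {a b : ℝ} (hab : a ≤ b)
    (hf : ContinuousOn f (Icc a b))
    (hd : ∀ x ∈ Ico a b, HasDerivWithinAt f (f' x) (Ici x) x)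
    (hc : ∀ x ∈ Ico a b, 0 ≤ f' x) : f a ≤ f b := by
  have := le_of_right_deriv_nonpos (f := fun x => -f x) (f' := fun x => -f' x) hab hf.neg
    (fun x hx => (hd x hx).neg) (fun x hx => by simpa using hc x hx)
  simpa using this

/-- A function whose right derivative is nonpositive wherever the function is at least `c` stays
below `c`. -/
theorem le_of_right_deriv_nonpos_of_ge {f f' : ℝ → ℝ} {a b c : ℝ} (hab : a ≤ b)
    (hf : ContinuousOn f (Icc a b))
    (hd : ∀ x ∈ Ico a b, HasDerivWithinAt f (f' x) (Ici x) x) (ha : f a ≤ c)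
    (hc : ∀ x ∈ Ico a b, c ≤ f x → f' x ≤ 0) : f b ≤ c := by
  -- The comparison theorem needs a strict inequality at contact, so the barrier `c` is tilted by a
  -- slope `ε`, which then tends to zero.
  have key : ∀ ε > 0, f b ≤ c + ε * (b - a) := fun ε hε => by
    have hB : ∀ x, HasDerivAt (fun x => c + ε * (x - a)) ε x := fun x => by
      simpa using (((hasDerivAt_id x).sub_const a).const_mul ε).const_add c
    refine image_le_of_deriv_right_lt_deriv_boundary (B := fun x => c + ε * (x - a))
      (B' := fun _ => ε) hf hd (by simpa using ha) hB ?_ (right_mem_Icc.2 hab)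
    intro x hx hxe
    refine (hc x hx ?_).trans_lt hε
    rw [hxe]
    have := mul_nonneg hε.le (sub_nonneg.2 hx.1)
    linarith
  refine le_of_forall_pos_le_add fun η hη => ?_
  rcases hab.eq_or_lt with rfl | hlt
  · simpa using ha.trans (by linarith)
  · have := key (η / (b - a)) (div_pos hη (sub_pos.2 hlt))
    rwa [div_mul_cancel₀ _ (sub_pos.2 hlt).ne'] at this

/-- A function with nonpositive product with its right derivative stays zero. -/
theorem eq_zero_of_mul_right_deriv_nonpos {f f' : ℝ → ℝ} {a b : ℝ} (hab : a ≤ b)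
    (hf : ContinuousOn f (Icc a b))
    (hd : ∀ x ∈ Ico a b, HasDerivWithinAt f (f' x) (Ici x) x) (ha : f a = 0)
    (hc : ∀ x ∈ Ico a b, f x * f' x ≤ 0) : f b = 0 := by
  -- The square of `f` does not increase and starts at zero.
  have := le_of_right_deriv_nonpos (f := fun x => f x ^ 2) (f' := fun x => 2 * (f x * f' x)) hab
    (hf.pow 2) (fun x hx => ((hd x hx).pow 2).congr_deriv (by simp; ring))
    (fun x hx => by linarith [hc x hx])
  simp only [ha] at this
  exact pow_eq_zero_iff (two_ne_zero) |>.1 (le_antisymm (by simpa using this) (sq_nonneg _))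

/-! ### The shape of a symmetric chain

The two arms have length `L`, and `H` is the component of the arms along the bisector. -/

/-- The speed of an outer robot at the end of an arm of length `L` (of at most `m` in a taut arm),
when the other end of the arm approaches with speed `c`. -/
def outerSpeed (τ m L c : ℝ) : ℝ := if L < m then 1 - τ else max 0 (min (1 - τ) c)

/-- The speed of the middle robot. -/
def middleSpeed (τ m L H : ℝ) : ℝ :=
  open Classical in if L = m ∨ 1 - τ < H / L then 1 else 0

theorem outerSpeed_nonneg {τ : ℝ} (hτ' : τ ≤ 1 / 2) (m L c : ℝ) : 0 ≤ outerSpeed τ m L c := by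
  unfold outerSpeed
  split_ifs
  · linarith
  · exact le_max_left _ _

theorem outerSpeed_le {τ : ℝ} (hτ' : τ ≤ 1 / 2) (m L c : ℝ) :
    outerSpeed τ m L c ≤ 1 - τ := by
  unfold outerSpeed
  split_ifs
  · exact le_rfl
  · exact max_le (by linarith) (min_le_left _ _)

theorem outerSpeed_le_of_ge {τ m L c : ℝ} (h : m ≤ L) (hc : 0 ≤ c) : outerSpeed τ m L c ≤ c := by
  rw [outerSpeed, if_neg h.not_gt]
  exact max_le hc (min_le_right _ _)

/-- The evolution of `H` and `L` before the chain becomes flat. -/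
structure IsShape (τ m T : ℝ) (H L : ℝ → ℝ) : Prop where
  continuousOn_H : ContinuousOn H (Icc 0 T)
  continuousOn_L : ContinuousOn L (Icc 0 T)
  pos : ∀ t ∈ Ico 0 T, 0 < H t
  le : ∀ t ∈ Ico 0 T, H t ≤ L t
  deriv_H : ∀ t ∈ Ico 0 T, HasDerivWithinAt H
    (outerSpeed τ m (L t) (middleSpeed τ m (L t) (H t) * (H t / L t)) * (H t / L t)
      - middleSpeed τ m (L t) (H t)) (Ici t) t
  deriv_L : ∀ t ∈ Ico 0 T, HasDerivWithinAt L
    (outerSpeed τ m (L t) (middleSpeed τ m (L t) (H t) * (H t / L t))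
      - middleSpeed τ m (L t) (H t) * (H t / L t)) (Ici t) t

theorem middleSpeed_nonneg (τ m L H : ℝ) : 0 ≤ middleSpeed τ m L H := by
  unfold middleSpeed
  split_ifs <;> norm_num

theorem middleSpeed_le_one (τ m L H : ℝ) : middleSpeed τ m L H ≤ 1 := by
  unfold middleSpeed
  split_ifs <;> norm_num

namespace IsShape

variable {τ m T : ℝ} {H L : ℝ → ℝ}

theorem pos_L (h : IsShape τ m T H L) {t : ℝ} (ht : t ∈ Ico 0 T) : 0 < L t :=
  (h.pos t ht).trans_le (h.le t ht)

/-- As soon as `L ≥ m`, the outer robot retreats no faster than the middle robot approaches, so `L`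
cannot cross `m`. -/
theorem length_le (h : IsShape τ m T H L) (h0 : L 0 ≤ m) {t : ℝ} (ht : t ∈ Icc 0 T) :
    L t ≤ m := by
  have hs : ∀ x ∈ Ico 0 t, x ∈ Ico 0 T := fun x hx => ⟨hx.1, hx.2.trans_le ht.2⟩
  refine le_of_right_deriv_nonpos_of_ge ht.1
    (h.continuousOn_L.mono (Icc_subset_Icc_right ht.2))
    (fun x hx => h.deriv_L x (hs x hx)) h0 fun x hx hm => ?_
  exact sub_nonpos.2 (outerSpeed_le_of_ge hm (mul_nonneg (middleSpeed_nonneg _ _ _ _)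
    (div_nonneg (h.pos x (hs x hx)).le (h.pos_L (hs x hx)).le)))

/-- The outer speed cancels: it only rescales the arms, and the angle changes through the middle
robot alone. -/
theorem deriv_ratio (h : IsShape τ m T H L) {t : ℝ} (ht : t ∈ Ico 0 T) :
    HasDerivWithinAt (fun t => H t / L t)
      (-(middleSpeed τ m (L t) (H t) * (1 - (H t / L t) ^ 2) / L t)) (Ici t) t := by
  have hL := (h.pos_L ht).ne'
  refine ((h.deriv_H t ht).div (h.deriv_L t ht) hL).congr_deriv ?_
  field_simp
  ring

theorem ratio_le_one (h : IsShape τ m T H L) {t : ℝ} (ht : t ∈ Ico 0 T) : H t / L t ≤ 1 :=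
  (div_le_one (h.pos_L ht)).2 (h.le t ht)

theorem ratio_pos (h : IsShape τ m T H L) {t : ℝ} (ht : t ∈ Ico 0 T) : 0 < H t / L t :=
  div_pos (h.pos t ht) (h.pos_L ht)

theorem ratio_antitone (h : IsShape τ m T H L) {s t : ℝ} (hs : 0 ≤ s) (hst : s ≤ t) (ht : t < T) :
    H t / L t ≤ H s / L s := by
  have hI : ∀ x ∈ Icc s t, x ∈ Ico 0 T := fun x hx => ⟨hs.trans hx.1, hx.2.trans_lt ht⟩
  have hc : Icc s t ⊆ Icc 0 T := Icc_subset_Icc hs ht.le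
  refine le_of_right_deriv_nonpos hst ((h.continuousOn_H.mono hc).div (h.continuousOn_L.mono hc)
    fun x hx => (h.pos_L (hI x hx)).ne')
    (fun x hx => h.deriv_ratio (hI x (Ico_subset_Icc_self hx))) fun x hx => ?_
  have hx := hI x (Ico_subset_Icc_self hx)
  have h1 := h.ratio_le_one hx
  have h2 := h.ratio_pos hx
  exact neg_nonpos.2 (div_nonneg (mul_nonneg (middleSpeed_nonneg _ _ _ _) (by nlinarith))
    (h.pos_L hx).le)

/-- The ratio is large only for a short time. -/
theorem le_of_lt_ratio (h : IsShape τ m T H L) (hτ : 0 < τ) (hτ' : τ ≤ 1 / 2) (h0 : L 0 ≤ m)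
    {t : ℝ} (ht : t ∈ Ico 0 T) (hr : 1 - τ < H t / L t) : t ≤ m / τ := by
  have hsub : Icc 0 t ⊆ Icc 0 T := Icc_subset_Icc_right ht.2.le
  -- By monotonicity the ratio exceeded `1 - τ` all the way up to `t`, so the middle speed was 1 and
  -- `H' ≤ (1 - τ)κ - 1 ≤ -τ`.
  have key := le_add_of_right_deriv_le (c := -τ) ht.1 (h.continuousOn_H.mono hsub)
    (fun x hx => h.deriv_H x ⟨hx.1, hx.2.trans ht.2⟩) fun x hx => by
      have hx' : x ∈ Ico 0 T := ⟨hx.1, hx.2.trans ht.2⟩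
      have h1 := hr.trans_le (h.ratio_antitone hx.1 hx.2.le ht.2)
      have h2 := h.ratio_le_one hx'
      have h3 := outerSpeed_le hτ' m (L x) (middleSpeed τ m (L x) (H x) * (H x / L x))
      have hμ : middleSpeed τ m (L x) (H x) = 1 := if_pos (Or.inr h1)
      rw [hμ] at h3 ⊢
      nlinarith [h.ratio_pos hx']
  have h1 := h.pos t ht
  have h2 := h.le 0 ⟨le_rfl, ht.1.trans_lt ht.2⟩
  rw [le_div_iff₀ hτ]
  linarith

/-- The potential `(m - L) / (1 - τ) + m / τ * (H / L)` decreases with rate at least one as soon as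
`H / L ≤ 1 - τ`. -/
theorem sub_le_potential (h : IsShape τ m T H L) (hτ : 0 < τ) (hτ' : τ ≤ 1 / 2) (hm : 0 < m)
    (h0 : L 0 ≤ m) {s t : ℝ} (hs : 0 ≤ s) (hst : s ≤ t) (ht : t < T) (hr : H s / L s ≤ 1 - τ) :
    t - s ≤ (m - L s) / (1 - τ) + m / τ * (H s / L s) := by
  have hI : ∀ x ∈ Icc s t, x ∈ Ico 0 T := fun x hx => ⟨hs.trans hx.1, hx.2.trans_lt ht⟩
  have hc : Icc s t ⊆ Icc 0 T := Icc_subset_Icc hs ht.le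
  have hd : ∀ x ∈ Ico s t, HasDerivWithinAt
      (fun x => (m - L x) / (1 - τ) + m / τ * (H x / L x)) _ (Ici x) x := fun x hx =>
    (((h.deriv_L x (hI x (Ico_subset_Icc_self hx))).const_sub m).div_const (1 - τ)).add
      ((h.deriv_ratio (hI x (Ico_subset_Icc_self hx))).const_mul (m / τ))
  have key := le_add_of_right_deriv_le (c := -1) hst
    (((continuousOn_const.sub (h.continuousOn_L.mono hc)).div_const (1 - τ)).add
      (((h.continuousOn_H.mono hc).div (h.continuousOn_L.mono hc)
        fun x hx => (h.pos_L (hI x hx)).ne').const_smul (m / τ))) hd fun x hx => by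
      have hx' := hI x (Ico_subset_Icc_self hx)
      have h1 := (h.ratio_antitone hs hx.1 hx'.2).trans hr
      have h2 := h.ratio_pos hx'
      have hLm := h.length_le h0 (Ico_subset_Icc_self hx')
      -- Slack arms: the first summand falls at rate exactly 1 and the ratio is constant. Taut arms:
      -- `L` is constant, and `1 - κ² ≥ 1 - κ ≥ τ` makes the second summand fall at rate at least 1.
      rcases hLm.lt_or_eq with hlt | heq
      · have hμ : middleSpeed τ m (L x) (H x) = 0 := if_neg (by
          rintro (h3 | h3) <;> linarith)
        rw [hμ, outerSpeed, if_pos hlt]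
        have : (1 : ℝ) - τ ≠ 0 := by linarith
        simp only [zero_mul, sub_zero, zero_div, neg_zero, mul_zero, add_zero]
        rw [neg_div, div_self this]
      · have hμ : middleSpeed τ m (L x) (H x) = 1 := if_pos (Or.inl heq)
        rw [heq] at h1 h2
        rw [hμ, outerSpeed, if_neg (by linarith), one_mul, heq, min_eq_right h1,
          max_eq_right h2.le, sub_self, neg_zero, zero_div, zero_add, mul_neg, neg_le_neg_iff, one_mul,
          div_mul_div_comm, mul_comm τ m, mul_div_mul_left _ _ hm.ne', le_div_iff₀ hτ]
        nlinarith
  have h1 := div_nonneg (sub_nonneg.2 (h.length_le h0 (hc (right_mem_Icc.2 hst))))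
    (show (0 : ℝ) ≤ 1 - τ by linarith)
  have h2 := mul_nonneg (div_nonneg hm.le hτ.le) (h.ratio_pos (hI t (right_mem_Icc.2 hst))).le
  change (m - L t) / (1 - τ) + m / τ * (H t / L t) ≤
    (m - L s) / (1 - τ) + m / τ * (H s / L s) + -1 * (t - s) at key
  linarith

/-- The first `m / τ` pays for the phase with large ratio; the bracket bounds the potential from
above. -/
theorem time_le (h : IsShape τ m T H L) (hτ : 0 < τ) (hτ' : τ ≤ 1 / 2) (hm : 0 < m)
    (h0 : L 0 ≤ m) : T ≤ m / τ + (m / (1 - τ) + m / τ) := by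
  have hmτ := div_pos hm hτ
  have h1τ : (0 : ℝ) < 1 - τ := by linarith
  by_contra! hT
  have hp := div_pos hm h1τ
  obtain ⟨t, ht, htT⟩ := exists_between hT
  have ht0 : t ∈ Ico 0 T := ⟨by linarith, htT⟩
  -- Half of the excess of `t` over the bound puts `s` strictly after the first phase and still
  -- leaves too long a second one.
  obtain ⟨s, hs, hst⟩ : ∃ s, m / τ < s ∧ m / τ + (m / (1 - τ) + m / τ) < t - s + m / τ :=
    ⟨m / τ + (t - (m / τ + (m / (1 - τ) + m / τ))) / 2, by linarith, by linarith⟩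
  have hsI : s ∈ Ico 0 T := ⟨by linarith, by linarith⟩
  have hr : H s / L s ≤ 1 - τ := by
    by_contra! hr
    linarith [h.le_of_lt_ratio hτ hτ' h0 hsI hr]
  have key := h.sub_le_potential hτ hτ' hm h0 hsI.1 (by linarith : s ≤ t) htT hr
  have h1 : (m - L s) / (1 - τ) ≤ m / (1 - τ) :=
    div_le_div_of_nonneg_right (by linarith [h.pos_L hsI]) h1τ.le
  have h2 : m / τ * (H s / L s) ≤ m / τ := mul_le_of_le_one_right hmτ.le (h.ratio_le_one hsI)
  linarith

/-- The arms are taut when the chain becomes flat. -/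
theorem taut_of_flat (h : IsShape τ m T H L) (hτ' : τ ≤ 1 / 2) (hT : 0 < T)
    (h0 : L 0 ≤ m) (hH : H T = 0) (hL : 0 < L T) : L T = m := by
  by_contra hne
  have hlt := (h.length_le h0 (right_mem_Icc.2 hT.le)).lt_of_ne hne
  have hTm : T ∈ Icc 0 T := right_mem_Icc.2 hT.le
  have hpos : ∀ t ∈ Icc 0 T, L t ≠ 0 := fun t ht => by
    rcases ht.2.lt_or_eq with h1 | rfl
    · exact (h.pos_L ⟨ht.1, h1⟩).ne'
    · exact hL.ne'
  have hcr := h.continuousOn_H.div h.continuousOn_L hpos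
  have e1 := (h.continuousOn_L T hTm).eventually_lt_const hlt
  have e2 : ∀ᶠ x in nhdsWithin T (Icc 0 T), H x / L x < 1 - τ :=
    (hcr T hTm : Filter.Tendsto _ _ _).eventually_lt_const (by simp [hH]; linarith)
  obtain ⟨ε, hε, hball⟩ := Metric.mem_nhdsWithin_iff.1 (e1.and e2)
  -- On `[s, T)` the arms are slack and the ratio is below `1 - τ`. Hence the middle robot rests and
  -- the ratio is constant, although it is positive at `s` and zero at `T`.
  set s := max 0 (T - ε / 2) with hs_def
  have hs0 : 0 ≤ s := le_max_left _ _
  have hsT : s < T := max_lt hT (by linarith)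
  have hc := constant_of_has_deriv_right_zero (hcr.mono (Icc_subset_Icc_left hs0))
    (fun x hx => by
      have hxI : x ∈ Ico 0 T := ⟨hs0.trans hx.1, hx.2⟩
      have hxb : x ∈ Metric.ball T ε := by
        rw [Metric.mem_ball, Real.dist_eq, abs_sub_lt_iff]
        have := (le_max_right 0 (T - ε / 2)).trans hx.1
        constructor <;> linarith [hx.2]
      have hh := hball ⟨hxb, Ico_subset_Icc_self hxI⟩
      refine (h.deriv_ratio hxI).congr_deriv ?_
      have hμ : middleSpeed τ m (L x) (H x) = 0 := if_neg (by
          rintro (h3 | h3)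
          · linarith [hh.1]
          · exact lt_asymm h3 hh.2)
      simp [hμ]) T (right_mem_Icc.2 hsT.le)
  have := h.ratio_pos ⟨hs0, hsT⟩
  simp only [Pi.div_apply, hH, zero_div] at hc
  linarith

end IsShape

/-! ### Chains that consist of two straight, equally spaced arms -/

/-- The position of `r_i` in the chain of `2 * m + 1` robots whose middle robot is at `x` and whose
outer robots are at `x + a` and `x + b`, where the robots of each arm are equally spaced. -/
def twoArms (m : ℕ) (x a b : Plane) (i : ℕ) : Plane :=
  x + if i ≤ m + 1 then (((m : ℝ) + 1 - i) / m) • a else (((i : ℝ) - (m + 1)) / m) • b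

/-- The second differences vanish, so the points form an arithmetic progression. -/
theorem eq_of_eq_midpoint {x : ℕ → Plane} {m : ℕ} (hm : 1 ≤ m)
    (h : ∀ j, j + 2 ≤ m → x (j + 1) = midpoint ℝ (x j) (x (j + 2))) {j : ℕ} (hj : j ≤ m) :
    x j = x 0 + ((j : ℝ) / m) • (x m - x 0) := by
  have key : ∀ j, j + 1 ≤ m → x j = x 0 + (j : ℝ) • (x 1 - x 0) ∧
      x (j + 1) = x 0 + ((j : ℝ) + 1) • (x 1 - x 0) := by
    intro j
    induction j with
    | zero => intro _; simp
    | succ j ih =>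
      intro hj
      obtain ⟨h1, h2⟩ := ih (by omega)
      refine ⟨by push_cast; exact h2, ?_⟩
      have h3 := h j (by omega)
      have h4 : x (j + 2) = (2 : ℝ) • x (j + 1) - x j := by
        rw [h3, midpoint_eq_smul_add, smul_smul]
        simp
      rw [show j + 1 + 1 = j + 2 from rfl, h4, h1, h2]
      push_cast
      module
  have h1 : ∀ j ≤ m, x j = x 0 + (j : ℝ) • (x 1 - x 0) := fun j hj => by
    rcases j with _ | j
    · simp
    · push_cast; exact (key j hj).2
  have hm0 : (m : ℝ) ≠ 0 := by positivity
  rw [h1 j hj, h1 m le_rfl, add_sub_cancel_left, smul_smul, div_mul_cancel₀ _ hm0]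

theorem eq_twoArms {q : ℕ → Plane} {m : ℕ} (hm : 1 ≤ m)
    (h : ∀ i, 2 ≤ i → i ≤ 2 * m → i ≠ m + 1 → q i = mid q i) {i : ℕ} (hi : 1 ≤ i)
    (hi' : i ≤ 2 * m + 1) :
    q i = twoArms m (q (m + 1)) (q 1 - q (m + 1)) (q (2 * m + 1) - q (m + 1)) i := by
  unfold twoArms
  split_ifs with hle
  · have := eq_of_eq_midpoint (x := fun j => q (m + 1 - j)) hm (fun j hj => by
      have := h (m + 1 - (j + 1)) (by omega) (by omega) (by omega)
      rw [mid, midpoint_comm] at this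
      rw [this]
      congr 2
      omega) (j := m + 1 - i) (by omega)
    simp only [Nat.sub_sub_self hle, Nat.sub_zero, Nat.add_sub_cancel_left,
      Nat.cast_sub hle] at this
    exact_mod_cast this
  · have := eq_of_eq_midpoint (x := fun j => q (m + 1 + j)) hm (fun j hj => by
      exact h (m + 1 + (j + 1)) (by omega) (by omega) (by omega)) (j := i - (m + 1)) (by omega)
    simp only [Nat.add_sub_cancel' (not_le.1 hle).le, Nat.cast_sub (not_le.1 hle).le] at this
    rw [show m + 1 + m = 2 * m + 1 by omega] at this
    exact_mod_cast this

section twoArms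

variable {m : ℕ} {x a b : Plane}

theorem twoArms_of_le {i : ℕ} (hi : i ≤ m + 1) :
    twoArms m x a b i = x + (((m : ℝ) + 1 - i) / m) • a := by
  rw [twoArms, if_pos hi]

theorem twoArms_of_ge {i : ℕ} (hi : m + 1 ≤ i) :
    twoArms m x a b i = x + (((i : ℝ) - (m + 1)) / m) • b := by
  rcases hi.eq_or_lt with rfl | hlt
  · rw [twoArms_of_le le_rfl]
    simp
  · rw [twoArms, if_neg (by omega)]

theorem twoArms_first (hm : 1 ≤ m) : twoArms m x a b 1 = x + a := by
  have : (m : ℝ) ≠ 0 := by positivity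
  rw [twoArms_of_le (by omega)]
  simp [this]

theorem twoArms_last (hm : 1 ≤ m) : twoArms m x a b (2 * m + 1) = x + b := by
  have : (m : ℝ) ≠ 0 := by positivity
  rw [twoArms_of_ge (by omega)]
  congr 1
  convert one_smul ℝ b
  push_cast
  field_simp
  ring

theorem twoArms_middle : twoArms m x a b (m + 1) = x := by
  rw [twoArms_of_le le_rfl]
  simp

theorem twoArms_sub_left :
    twoArms m x a b m - twoArms m x a b (m + 1) = (1 / (m : ℝ)) • a := by
  rw [twoArms_middle, twoArms_of_le (by omega)]
  simp

theorem twoArms_sub_right :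
    twoArms m x a b (m + 2) - twoArms m x a b (m + 1) = (1 / (m : ℝ)) • b := by
  rw [twoArms_middle, twoArms_of_ge (by omega)]
  push_cast
  rw [add_sub_cancel_left]
  congr 2
  ring

theorem link_twoArms_of_le {i : ℕ} (hi : 2 ≤ i) (hi' : i ≤ m + 1) :
    link (twoArms m x a b) i = -((1 / (m : ℝ)) • a) := by
  obtain ⟨j, rfl⟩ : ∃ j, i = j + 1 := ⟨i - 1, by omega⟩
  rw [link, Nat.add_sub_cancel, twoArms_of_le hi', twoArms_of_le (by omega)]
  push_cast
  module

theorem link_twoArms_of_ge {i : ℕ} (hi : m + 2 ≤ i) :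
    link (twoArms m x a b) i = (1 / (m : ℝ)) • b := by
  obtain ⟨j, rfl⟩ : ∃ j, i = j + 1 := ⟨i - 1, by omega⟩
  rw [link, Nat.add_sub_cancel, twoArms_of_ge (by omega), twoArms_of_ge (by omega)]
  push_cast
  module

theorem twoArms_eq_mid {i : ℕ} (hi : 2 ≤ i) (hne : i ≠ m + 1) :
    twoArms m x a b i = mid (twoArms m x a b) i := by
  obtain ⟨j, rfl⟩ : ∃ j, i = j + 1 := ⟨i - 1, by omega⟩
  rw [mid, midpoint_eq_smul_add]
  simp only [Nat.add_sub_cancel]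
  rcases lt_or_gt_of_ne hne with h | h
  · rw [twoArms_of_le (by omega), twoArms_of_le (by omega), twoArms_of_le (by omega)]
    push_cast
    simp only [invOf_eq_inv]
    module
  · rw [twoArms_of_ge (by omega), twoArms_of_ge (by omega), twoArms_of_ge (by omega)]
    push_cast
    simp only [invOf_eq_inv]
    module

theorem middle_eq_mid_twoArms_iff (hm : 1 ≤ m) :
    twoArms m x a b (m + 1) = mid (twoArms m x a b) (m + 1) ↔ a + b = 0 := by
  have hm0 : (m : ℝ) ≠ 0 := by positivity
  have h1 := sub_eq_iff_eq_add.1 (twoArms_sub_left (m := m) (x := x) (a := a) (b := b))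
  have h2 := sub_eq_iff_eq_add.1 (twoArms_sub_right (m := m) (x := x) (a := a) (b := b))
  rw [mid, Nat.add_sub_cancel, h1, h2, twoArms_middle, midpoint_eq_smul_add]
  have : (⅟2 : ℝ) • ((1 / (m : ℝ)) • a + x + ((1 / (m : ℝ)) • b + x))
      = x + (1 / 2 * (1 / (m : ℝ))) • (a + b) := by
    simp only [invOf_eq_inv]
    module
  rw [this, left_eq_add, smul_eq_zero]
  simp [hm0]

theorem chainAngle_twoArms (hm : 1 ≤ m) :
    chainAngle (twoArms m x a b) (m + 1) = InnerProductGeometry.angle a b := by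
  have hm0 : 0 < 1 / (m : ℝ) := by positivity
  rw [chainAngle, EuclideanGeometry.angle, Nat.add_sub_cancel, vsub_eq_sub, vsub_eq_sub,
    twoArms_sub_left, twoArms_sub_right, InnerProductGeometry.angle_smul_left_of_pos _ _ hm0,
    InnerProductGeometry.angle_smul_right_of_pos _ _ hm0]

theorem bisectorDir_twoArms (hm : 1 ≤ m) :
    bisectorDir (twoArms m x a b) (m + 1)
      = NormedSpace.normalize (NormedSpace.normalize a + NormedSpace.normalize b) := by
  have hm0 : 0 < 1 / (m : ℝ) := by positivity
  rw [bisectorDir, Nat.add_sub_cancel, twoArms_sub_left, twoArms_sub_right,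
    NormedSpace.normalize_smul_of_pos hm0, NormedSpace.normalize_smul_of_pos hm0]

/-- The vectors `a` and `b` are parallel. -/
def IsFlat (a b : Plane) : Prop :=
  inner ℝ a b ^ 2 = ‖a‖ ^ 2 * ‖b‖ ^ 2

/-- Collinearity means that the Gram determinant of the arms vanishes, which includes degenerate
arms. The polynomial form of `IsFlat` later makes the set of flat times closed. -/
theorem isFlatAt_twoArms_iff (hm : 1 ≤ m) :
    IsFlatAt (twoArms m x a b) (m + 1) ↔ IsFlat a b := by
  have hm0 : (m : ℝ) ≠ 0 := by positivity
  have h1 := twoArms_sub_left (m := m) (x := x) (a := a) (b := b)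
  have h2 := twoArms_sub_right (m := m) (x := x) (a := a) (b := b)
  have h0 : EuclideanGeometry.angle (twoArms m x a b m) (twoArms m x a b (m + 1))
      (twoArms m x a b (m + 1 + 1)) = InnerProductGeometry.angle a b := chainAngle_twoArms hm
  rw [IsFlatAt, Nat.add_sub_cancel, EuclideanGeometry.collinear_iff_eq_or_eq_or_sin_eq_zero,
    h0, ← sub_eq_zero, h1,
    ← sub_eq_zero (a := twoArms m x a b (m + 1 + 1)), h2]
  have h3 := InnerProductGeometry.sin_angle_mul_norm_mul_norm a b
  have h4 : 0 ≤ inner ℝ a a * inner ℝ b b - inner ℝ a b * inner ℝ a b :=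
    sub_nonneg.2 (real_inner_mul_inner_self_le a b)
  have h5 : inner ℝ a a * inner ℝ b b - inner ℝ a b * inner ℝ a b
      = ‖a‖ ^ 2 * ‖b‖ ^ 2 - inner ℝ a b ^ 2 := by
    rw [real_inner_self_eq_norm_sq, real_inner_self_eq_norm_sq]; ring
  rw [h5] at h3 h4
  have h6 : IsFlat a b ↔ Real.sqrt (‖a‖ ^ 2 * ‖b‖ ^ 2 - inner ℝ a b ^ 2) = 0 := by
    rw [Real.sqrt_eq_zero h4, sub_eq_zero, eq_comm, IsFlat]
  rw [h6, ← h3]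
  simp only [one_div, smul_eq_zero, inv_eq_zero, hm0, false_or, mul_eq_zero, norm_eq_zero]
  tauto

theorem isFlatAt_twoArms_of_ne {i : ℕ} (hi : 2 ≤ i) (hne : i ≠ m + 1) :
    IsFlatAt (twoArms m x a b) i := by
  rw [IsFlatAt, twoArms_eq_mid hi hne, mid]
  exact (wbtw_midpoint ℝ _ _).collinear

theorem norm_smul_lt_one_iff (hm : 1 ≤ m) : ‖(1 / (m : ℝ)) • a‖ < 1 ↔ ‖a‖ < m := by
  have hm0 : 0 < (m : ℝ) := by positivity
  rw [norm_smul, Real.norm_of_nonneg (by positivity), one_div, inv_mul_eq_div, div_lt_one hm0]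

theorem norm_smul_eq_one_iff (hm : 1 ≤ m) : ‖(1 / (m : ℝ)) • a‖ = 1 ↔ ‖a‖ = m := by
  have hm0 : 0 < (m : ℝ) := by positivity
  rw [norm_smul, Real.norm_of_nonneg (by positivity), one_div, inv_mul_eq_div,
    div_eq_one_iff_eq hm0.ne']

theorem isMaxChain_twoArms (hm : 1 ≤ m) (hab : a + b = 0) (ha : ‖a‖ = m) :
    IsMaxChain (2 * m + 1) (twoArms m x a b) := by
  obtain rfl : b = -a := (neg_eq_of_add_eq_zero_right hab).symm
  have h : ∀ i, 2 ≤ i → link (twoArms m x a (-a)) i = -((1 / (m : ℝ)) • a) := fun i hi => by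
    rcases le_or_gt i (m + 1) with hi' | hi'
    · exact link_twoArms_of_le hi hi'
    · rw [link_twoArms_of_ge hi', smul_neg]
  refine ⟨fun i hi _ => ?_, fun i hi _ => ?_⟩
  · rw [h i hi, norm_neg, norm_smul_eq_one_iff hm, ha]
  · rw [h i hi, h (i + 1) (by omega)]

end twoArms

/-- The speed of an outer robot in terms of the velocities of both ends of its arm. -/
theorem eq_outerVelocity_iff {τ : ℝ} (hτ' : τ ≤ 1 / 2) {m : ℕ} (hm : 1 ≤ m) {x y a u w z : Plane}
    (hxy : x - y = (1 / (m : ℝ)) • a) (ha : a ≠ 0)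
    (hz : z = u + (((m : ℝ) - 1) / m) • (w - u)) :
    w = outerVelocity τ x y z ↔
      w = outerSpeed τ m ‖a‖ (inner ℝ u (NormedSpace.normalize a)) • NormedSpace.normalize a := by
  have hm0 : 0 < (m : ℝ) := by positivity
  have hm1 : (1 : ℝ) ≤ m := by exact_mod_cast hm
  rw [outerVelocity, outerSpeed, hxy, NormedSpace.normalize_smul_of_pos (by positivity)]
  simp only [norm_smul_lt_one_iff hm]
  split_ifs with h
  · rfl
  set e := NormedSpace.normalize a with he
  have hee : inner ℝ e e = 1 := by
    rw [real_inner_self_eq_norm_sq, NormedSpace.norm_normalize ha]; norm_num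
  -- Along the arm, with `d` and `c` the approach speeds of the neighbor and of the far end, `m d =
  -- c + (m - 1) s`. Therefore clamping `d` or `c` to `[0, 1 - τ]` determines the same `s`, as the
  -- three clamping cases show.
  have hwz : ∀ s : ℝ, w = s • e →
      m * inner ℝ z e = inner ℝ u e + ((m : ℝ) - 1) * s := by
    intro s hs
    rw [hz, hs, inner_add_left, inner_smul_left, inner_sub_left, inner_smul_left, hee]
    simp only [conj_trivial]
    field_simp
    ring
  constructor
  · intro hw
    have h1 := hwz _ hw
    set d := inner ℝ z e
    set c := inner ℝ u e
    rw [hw]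
    congr 1
    rcases le_total d 0 with hd | hd
    · have h2 : max 0 (min (1 - τ) d) = 0 := max_eq_left ((min_le_right _ _).trans hd)
      rw [h2] at h1 ⊢
      have hc : c ≤ 0 := by nlinarith
      exact (max_eq_left ((min_le_right _ _).trans hc)).symm
    · rcases le_total d (1 - τ) with hd' | hd'
      · have h2 : max 0 (min (1 - τ) d) = d := by rw [min_eq_right hd', max_eq_right hd]
        rw [h2] at h1 ⊢
        have hc : c = d := by linarith
        rw [hc, h2]
      · have h2 : max 0 (min (1 - τ) d) = 1 - τ := by
          rw [min_eq_left hd', max_eq_right (by linarith)]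
        rw [h2] at h1 ⊢
        have hc : 1 - τ ≤ c := by nlinarith
        rw [min_eq_left hc, max_eq_right (by linarith)]
  · intro hw
    have h1 := hwz _ hw
    set d := inner ℝ z e
    set c := inner ℝ u e
    rw [hw]
    congr 1
    rcases le_total c 0 with hd | hd
    · have h2 : max 0 (min (1 - τ) c) = 0 := max_eq_left ((min_le_right _ _).trans hd)
      rw [h2] at h1 ⊢
      have hc : d ≤ 0 := by nlinarith
      exact (max_eq_left ((min_le_right _ _).trans hc)).symm
    · rcases le_total c (1 - τ) with hd' | hd'
      · have h2 : max 0 (min (1 - τ) c) = c := by rw [min_eq_right hd', max_eq_right hd]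
        rw [h2] at h1 ⊢
        have hc : d = c := by
          have : (m : ℝ) * d = m * c := by linarith
          exact mul_left_cancel₀ hm0.ne' this
        rw [hc, h2]
      · have h2 : max 0 (min (1 - τ) c) = 1 - τ := by
          rw [min_eq_left hd', max_eq_right (by linarith)]
        rw [h2] at h1 ⊢
        have hc : 1 - τ ≤ d := by nlinarith
        rw [min_eq_left hc, max_eq_right (by linarith)]

/-! ### The geometry at the middle robot -/

/-- For equal norms, `‖a + b‖² ‖a - b‖²` is four times the Gram determinant. -/
theorem IsFlat.add_eq_zero_or_eq {a b : Plane} (h : IsFlat a b) (hab : ‖a‖ = ‖b‖) :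
    a + b = 0 ∨ a = b := by
  have h1 : ‖a + b‖ ^ 2 * ‖a - b‖ ^ 2 = 0 := by
    have h2 : inner ℝ a b ^ 2 = ‖a‖ ^ 2 * ‖b‖ ^ 2 := h
    rw [norm_add_sq_real, norm_sub_sq_real]
    rw [hab] at h2 ⊢
    linear_combination (-4) * h2
  rcases mul_eq_zero.1 h1 with h2 | h2
  · exact Or.inl (by simpa using h2)
  · exact Or.inr (sub_eq_zero.1 (by simpa using h2))

theorem isFlat_of_add_eq_zero {a b : Plane} (h : a + b = 0) : IsFlat a b := by
  obtain rfl : b = -a := (neg_eq_of_add_eq_zero_right h).symm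
  rw [IsFlat, inner_neg_right, real_inner_self_eq_norm_sq, norm_neg]
  ring

theorem isFlat_self (a : Plane) : IsFlat a a := by
  rw [IsFlat, real_inner_self_eq_norm_sq]
  ring

theorem ne_zero_of_not_isFlat {a b : Plane} (h : ¬ IsFlat a b) :
    a ≠ 0 ∧ b ≠ 0 ∧ a + b ≠ 0 ∧ a - b ≠ 0 := by
  refine ⟨?_, ?_, fun h0 => h (isFlat_of_add_eq_zero h0), ?_⟩
  · rintro rfl; exact h (by simp [IsFlat])
  · rintro rfl; exact h (by simp [IsFlat])
  · intro h0
    rw [sub_eq_zero] at h0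
    exact h (h0 ▸ isFlat_self a)

/-- The direction of the bisector of the angle between `a` and `b`. -/
def bisector (a b : Plane) : Plane :=
  NormedSpace.normalize (NormedSpace.normalize a + NormedSpace.normalize b)

theorem inner_bisector_eq {a b : Plane} (ha : a ≠ 0) (hb : b ≠ 0) :
    inner ℝ (bisector a b) (NormedSpace.normalize a)
        = inner ℝ (bisector a b) (NormedSpace.normalize b) ∧
      0 ≤ inner ℝ (bisector a b) (NormedSpace.normalize a) := by
  rw [bisector]
  set e := NormedSpace.normalize a
  set f := NormedSpace.normalize b
  have he : ‖e‖ = 1 := NormedSpace.norm_normalize ha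
  have hf : ‖f‖ = 1 := NormedSpace.norm_normalize hb
  have h1 := (abs_le.1 (abs_real_inner_le_norm e f)).1
  have h2 : inner ℝ e e = 1 := by rw [real_inner_self_eq_norm_sq, he]; norm_num
  have h3 : inner ℝ f f = 1 := by rw [real_inner_self_eq_norm_sq, hf]; norm_num
  rw [he, hf] at h1
  rw [NormedSpace.normalize, inner_smul_left, inner_smul_left, inner_add_left, inner_add_left,
    h2, h3, real_inner_comm e f]
  simp only [conj_trivial]
  refine ⟨by ring, mul_nonneg (by positivity) (by linarith)⟩

theorem bisector_eq_of_norm_eq {a b : Plane} (ha : a ≠ 0) (hab : ‖a‖ = ‖b‖) :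
    bisector a b = NormedSpace.normalize (a + b) := by
  have h : NormedSpace.normalize a + NormedSpace.normalize b = ‖a‖⁻¹ • (a + b) := by
    rw [NormedSpace.normalize, NormedSpace.normalize, ← hab, smul_add]
  rw [bisector, h, NormedSpace.normalize_smul_of_pos (by positivity)]

theorem inner_normalize_add {a b : Plane} (h : a + b ≠ 0) (hab : ‖a‖ = ‖b‖) :
    inner ℝ (NormedSpace.normalize (a + b)) (NormedSpace.normalize a) = ‖a + b‖ / 2 / ‖a‖ := by
  have h1 : ‖a + b‖ ^ 2 = 2 * inner ℝ (a + b) a := by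
    rw [norm_add_sq_real, inner_add_left, real_inner_self_eq_norm_sq, real_inner_comm a b, hab]
    ring
  rw [NormedSpace.normalize, NormedSpace.normalize, inner_smul_left, inner_smul_right]
  simp only [conj_trivial]
  have h2 : ‖a + b‖ ≠ 0 := norm_ne_zero_iff.2 h
  have h3 : inner ℝ (a + b) a = ‖a + b‖ ^ 2 / 2 := by linarith
  rw [h3]
  field_simp

/-- Both sides are nonnegative, and their squares agree by the half-angle formula. -/
theorem cos_half_angle {a b : Plane} (ha : a ≠ 0) (hab : ‖a‖ = ‖b‖) :
    Real.cos (InnerProductGeometry.angle a b / 2) = ‖a + b‖ / 2 / ‖a‖ := by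
  have hL : ‖a‖ ≠ 0 := norm_ne_zero_iff.2 ha
  have h0 := InnerProductGeometry.angle_nonneg a b
  have h1 := InnerProductGeometry.angle_le_pi a b
  have h2 := Real.cos_sq (InnerProductGeometry.angle a b / 2)
  rw [mul_div_cancel₀ _ two_ne_zero, InnerProductGeometry.cos_angle] at h2
  refine (sq_eq_sq₀ (Real.cos_nonneg_of_mem_Icc ⟨by linarith, by linarith⟩)
    (by positivity)).1 (h2.trans ?_)
  rw [div_pow, div_pow, norm_add_sq_real, ← hab]
  field_simp
  ring

/-- Cosine reverses order on half angles; this is what turns the threshold `psi τ` into the test `1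
- τ < H / L` in `middleSpeed`. -/
theorem angle_lt_psi_iff {τ : ℝ} (hτ : 0 < τ) (hτ' : τ ≤ 1 / 2) {a b : Plane} (ha : a ≠ 0)
    (hab : ‖a‖ = ‖b‖) :
    InnerProductGeometry.angle a b < psi τ ↔ 1 - τ < ‖a + b‖ / 2 / ‖a‖ := by
  have h0 := InnerProductGeometry.angle_nonneg a b
  have h1 := InnerProductGeometry.angle_le_pi a b
  rw [← cos_half_angle ha hab, psi]
  conv_rhs => rw [← Real.cos_arccos (show -1 ≤ 1 - τ by linarith) (show 1 - τ ≤ 1 by linarith)]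
  rw [Real.strictAntiOn_cos.lt_iff_gt ⟨Real.arccos_nonneg _, Real.arccos_le_pi _⟩
    ⟨by linarith, by linarith⟩]
  constructor <;> intro h <;> linarith

theorem _root_.HasDerivWithinAt.norm_of_ne_zero {f : ℝ → Plane} {f' : Plane} {s : Set ℝ} {t : ℝ}
    (h : HasDerivWithinAt f f' s t) (h0 : f t ≠ 0) :
    HasDerivWithinAt (fun t => ‖f t‖) (inner ℝ (NormedSpace.normalize (f t)) f') s t := by
  have h1 := (h.norm_sq).sqrt (pow_ne_zero 2 (norm_ne_zero_iff.2 h0))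
  simp only [Real.sqrt_sq (norm_nonneg _)] at h1
  refine h1.congr_deriv ?_
  rw [NormedSpace.normalize, inner_smul_left]
  simp only [conj_trivial]
  field_simp

/-! ### The motion of two straight arms -/

/-- The velocities `u` of the middle robot and `u + a'`, `u + b'` of the outer robots obey the
strategy, when the outer robots are at the positions `a` and `b` relative to the middle robot. -/
structure IsArmVelocity (τ m : ℝ) (a b u a' b' : Plane) : Prop where
  first : u + a' = outerSpeed τ m ‖a‖ (inner ℝ u (NormedSpace.normalize a)) •
    NormedSpace.normalize a
  last : u + b' = outerSpeed τ m ‖b‖ (inner ℝ u (NormedSpace.normalize b)) •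
    NormedSpace.normalize b
  move : ‖a‖ = m ∨ ‖b‖ = m ∨ InnerProductGeometry.angle a b < psi τ → u = bisector a b
  rest : ¬ (‖a‖ = m ∨ ‖b‖ = m ∨ InnerProductGeometry.angle a b < psi τ) → u = 0

namespace IsArmVelocity

variable {τ m : ℝ} {a b u a' b' : Plane}

/-- The middle velocity is zero or along the bisector, so both arms see the same approach speed,
even before their lengths are known to agree. -/
theorem inner_eq (h : IsArmVelocity τ m a b u a' b') (ha : a ≠ 0) (hb : b ≠ 0) :
    inner ℝ u (NormedSpace.normalize a) = inner ℝ u (NormedSpace.normalize b) ∧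
      0 ≤ inner ℝ u (NormedSpace.normalize a) := by
  by_cases hc : ‖a‖ = m ∨ ‖b‖ = m ∨ InnerProductGeometry.angle a b < psi τ
  · rw [h.move hc]
    exact inner_bisector_eq ha hb
  · simp [h.rest hc]

theorem eq_middleSpeed (h : IsArmVelocity τ m a b u a' b') (hτ : 0 < τ) (hτ' : τ ≤ 1 / 2)
    (ha : a ≠ 0) (hab : ‖a‖ = ‖b‖) :
    u = middleSpeed τ m ‖a‖ (‖a + b‖ / 2) • NormedSpace.normalize (a + b) := by
  have h1 := angle_lt_psi_iff hτ hτ' ha hab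
  by_cases hc : ‖a‖ = m ∨ ‖b‖ = m ∨ InnerProductGeometry.angle a b < psi τ
  · rw [h.move hc, bisector_eq_of_norm_eq ha hab, middleSpeed, if_pos, one_smul]
    rwa [← hab, or_self_left, h1] at hc
  · rw [h.rest hc, middleSpeed, if_neg, zero_smul]
    rwa [← hab, or_self_left, h1] at hc

theorem inner_deriv_first (h : IsArmVelocity τ m a b u a' b') (ha : a ≠ 0) :
    inner ℝ (NormedSpace.normalize a) a' =
      outerSpeed τ m ‖a‖ (inner ℝ u (NormedSpace.normalize a))
        - inner ℝ u (NormedSpace.normalize a) := by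
  rw [eq_sub_of_add_eq' h.first, inner_sub_right, inner_smul_right, real_inner_self_eq_norm_sq,
    NormedSpace.norm_normalize ha, real_inner_comm u]
  ring

theorem inner_deriv_last (h : IsArmVelocity τ m a b u a' b') (hb : b ≠ 0) :
    inner ℝ (NormedSpace.normalize b) b' =
      outerSpeed τ m ‖b‖ (inner ℝ u (NormedSpace.normalize b))
        - inner ℝ u (NormedSpace.normalize b) := by
  rw [eq_sub_of_add_eq' h.last, inner_sub_right, inner_smul_right, real_inner_self_eq_norm_sq,
    NormedSpace.norm_normalize hb, real_inner_comm u]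
  ring

end IsArmVelocity

/-- A motion of two arms, until the chain becomes flat. -/
structure IsArmMotion (τ m T : ℝ) (a b u a' b' : ℝ → Plane) : Prop where
  continuousOn_a : ContinuousOn a (Icc 0 T)
  continuousOn_b : ContinuousOn b (Icc 0 T)
  not_isFlat : ∀ t ∈ Ico 0 T, ¬ IsFlat (a t) (b t)
  deriv_a : ∀ t ∈ Ico 0 T, HasDerivWithinAt a (a' t) (Ici t) t
  deriv_b : ∀ t ∈ Ico 0 T, HasDerivWithinAt b (b' t) (Ici t) t
  rule : ∀ t ∈ Ico 0 T, IsArmVelocity τ m (a t) (b t) (u t) (a' t) (b' t)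

namespace IsArmMotion

variable {τ m T : ℝ} {a b u a' b' : ℝ → Plane}

/-- The approach speed is common to both arms, and an outer robot is fastest when its arm is shorter
than `m`. Hence the longer arm never grows faster, and the squared difference cannot increase. -/
theorem norm_eq (h : IsArmMotion τ m T a b u a' b') (hτ' : τ ≤ 1 / 2) (h0 : ‖a 0‖ = ‖b 0‖)
    {t : ℝ} (ht : t ∈ Icc 0 T) : ‖a t‖ = ‖b t‖ := by
  have hs : ∀ x ∈ Ico 0 t, x ∈ Ico 0 T := fun x hx => ⟨hx.1, hx.2.trans_le ht.2⟩
  have hc : Icc 0 t ⊆ Icc 0 T := Icc_subset_Icc_right ht.2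
  refine sub_eq_zero.1 (eq_zero_of_mul_right_deriv_nonpos (f := fun t => ‖a t‖ - ‖b t‖) ht.1
    ((h.continuousOn_a.mono hc).norm.sub (h.continuousOn_b.mono hc).norm)
    (fun x hx => by
      obtain ⟨ha, hb, -⟩ := ne_zero_of_not_isFlat (h.not_isFlat x (hs x hx))
      exact ((h.deriv_a x (hs x hx)).norm_of_ne_zero ha).sub
        ((h.deriv_b x (hs x hx)).norm_of_ne_zero hb)) (by simp [h0]) fun x hx => ?_)
  obtain ⟨ha, hb, -⟩ := ne_zero_of_not_isFlat (h.not_isFlat x (hs x hx))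
  have hr := h.rule x (hs x hx)
  rw [hr.inner_deriv_first ha, hr.inner_deriv_last hb, ← (hr.inner_eq ha hb).1]
  set c := inner ℝ (u x) (NormedSpace.normalize (a x))
  have h1 := outerSpeed_le hτ' m ‖a x‖ c
  have h2 := outerSpeed_le hτ' m ‖b x‖ c
  show (‖a x‖ - ‖b x‖) * _ ≤ 0
  rcases lt_or_ge ‖a x‖ m with h3 | h3 <;> rcases lt_or_ge ‖b x‖ m with h4 | h4
  · simp [outerSpeed, h3, h4]
  · have h5 : outerSpeed τ m ‖a x‖ c = 1 - τ := if_pos h3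
    exact mul_nonpos_of_nonpos_of_nonneg (by linarith) (by linarith)
  · have h5 : outerSpeed τ m ‖b x‖ c = 1 - τ := if_pos h4
    exact mul_nonpos_of_nonneg_of_nonpos (by linarith) (by linarith)
  · simp [outerSpeed, h3.not_gt, h4.not_gt]

theorem eq_smul_sub (h : IsArmMotion τ m T a b u a' b') (hτ' : τ ≤ 1 / 2) (h0 : ‖a 0‖ = ‖b 0‖)
    {t : ℝ} (ht : t ∈ Ico 0 T) :
    ∃ s, s = outerSpeed τ m ‖a t‖ (inner ℝ (u t) (NormedSpace.normalize (a t))) ∧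
      a' t = (s / ‖a t‖) • a t - u t ∧ b' t = (s / ‖a t‖) • b t - u t := by
  obtain ⟨ha, hb, -⟩ := ne_zero_of_not_isFlat (h.not_isFlat t ht)
  have hr := h.rule t ht
  have hn := h.norm_eq hτ' h0 (Ico_subset_Icc_self ht)
  refine ⟨_, rfl, ?_, ?_⟩
  · rw [eq_sub_of_add_eq' hr.first, NormedSpace.normalize, smul_smul, div_eq_mul_inv]
  · rw [eq_sub_of_add_eq' hr.last, ← (hr.inner_eq ha hb).1, ← hn, NormedSpace.normalize,
      NormedSpace.normalize, smul_smul, ← hn, div_eq_mul_inv]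

theorem isShape (h : IsArmMotion τ m T a b u a' b') (hτ : 0 < τ) (hτ' : τ ≤ 1 / 2)
    (h0 : ‖a 0‖ = ‖b 0‖) :
    IsShape τ m T (fun t => ‖a t + b t‖ / 2) (fun t => ‖a t‖) where
  continuousOn_H := (h.continuousOn_a.add h.continuousOn_b).norm.div_const 2
  continuousOn_L := h.continuousOn_a.norm
  pos t ht := by
    have := (ne_zero_of_not_isFlat (h.not_isFlat t ht)).2.2.1
    positivity
  le t ht := by
    have h1 := norm_add_le (a t) (b t)
    rw [← h.norm_eq hτ' h0 (Ico_subset_Icc_self ht)] at h1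
    linarith
  deriv_H t ht := by
    obtain ⟨ha, hb, hs, hd⟩ := ne_zero_of_not_isFlat (h.not_isFlat t ht)
    have hn := h.norm_eq hτ' h0 (Ico_subset_Icc_self ht)
    have hu := (h.rule t ht).eq_middleSpeed hτ hτ' ha hn
    obtain ⟨s, hs', h1, h2⟩ := h.eq_smul_sub hτ' h0 ht
    refine ((((h.deriv_a t ht).add (h.deriv_b t ht)).norm_of_ne_zero hs).div_const 2).congr_deriv ?_
    have h3 : inner ℝ (u t) (NormedSpace.normalize (a t)) = middleSpeed τ m ‖a t‖ (‖a t + b t‖ / 2)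
        * (‖a t + b t‖ / 2 / ‖a t‖) := by
      rw [← inner_normalize_add hs hn]
      nth_rewrite 1 [hu]
      rw [inner_smul_left, conj_trivial]
    rw [← h3, ← hs', Pi.add_apply, h1, h2]
    have h4 : (s / ‖a t‖) • a t - u t + ((s / ‖a t‖) • b t - u t)
        = (s / ‖a t‖) • (a t + b t) - (2 : ℝ) • u t := by module
    have h5 : inner ℝ (NormedSpace.normalize (a t + b t)) (a t + b t) = ‖a t + b t‖ := by
      rw [NormedSpace.normalize, inner_smul_left, real_inner_self_eq_norm_sq, conj_trivial]
      field_simp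
    have h6 : inner ℝ (NormedSpace.normalize (a t + b t)) (u t)
        = middleSpeed τ m ‖a t‖ (‖a t + b t‖ / 2) := by
      nth_rewrite 1 [hu]
      rw [inner_smul_right, real_inner_self_eq_norm_sq, NormedSpace.norm_normalize hs]
      ring
    rw [h4, inner_sub_right, inner_smul_right, inner_smul_right, h5, h6]
    ring
  deriv_L t ht := by
    obtain ⟨ha, hb, hs, hd⟩ := ne_zero_of_not_isFlat (h.not_isFlat t ht)
    have hn := h.norm_eq hτ' h0 (Ico_subset_Icc_self ht)
    have hu := (h.rule t ht).eq_middleSpeed hτ hτ' ha hn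
    refine ((h.deriv_a t ht).norm_of_ne_zero ha).congr_deriv ?_
    rw [(h.rule t ht).inner_deriv_first ha, ← inner_normalize_add hs hn]
    have h3 : inner ℝ (u t) (NormedSpace.normalize (a t)) = middleSpeed τ m ‖a t‖ (‖a t + b t‖ / 2)
        * inner ℝ (NormedSpace.normalize (a t + b t)) (NormedSpace.normalize (a t)) := by
      nth_rewrite 1 [hu]
      rw [inner_smul_left, conj_trivial]
    rw [h3]

/-- In `a' - b'` the middle velocity cancels, leaving a nonnegative multiple of `a - b`. This
prevents the arms from folding together. -/
theorem norm_sub_ge (h : IsArmMotion τ m T a b u a' b') (hτ' : τ ≤ 1 / 2)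
    (h0 : ‖a 0‖ = ‖b 0‖) {t : ℝ} (ht : t ∈ Icc 0 T) : ‖a 0 - b 0‖ ≤ ‖a t - b t‖ := by
  have hs : ∀ x ∈ Ico 0 t, x ∈ Ico 0 T := fun x hx => ⟨hx.1, hx.2.trans_le ht.2⟩
  have hc : Icc 0 t ⊆ Icc 0 T := Icc_subset_Icc_right ht.2
  refine le_of_right_deriv_nonneg (f := fun t => ‖a t - b t‖) ht.1
    ((h.continuousOn_a.mono hc).sub (h.continuousOn_b.mono hc)).norm
    (fun x hx => ((h.deriv_a x (hs x hx)).sub (h.deriv_b x (hs x hx))).norm_of_ne_zero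
      (ne_zero_of_not_isFlat (h.not_isFlat x (hs x hx))).2.2.2) fun x hx => ?_
  obtain ⟨s, hs', h1, h2⟩ := h.eq_smul_sub hτ' h0 (hs x hx)
  have h3 : a' x - b' x = (s / ‖a x‖) • (a x - b x) := by rw [h1, h2]; module
  rw [h3, Pi.sub_apply, inner_smul_right, NormedSpace.normalize, inner_smul_left,
    real_inner_self_eq_norm_sq, conj_trivial, hs']
  have := outerSpeed_nonneg hτ' m ‖a x‖ (inner ℝ (u x) (NormedSpace.normalize (a x)))
  positivity

end IsArmMotion

/-- The chain is taut and stretched after a bounded time. -/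
theorem exists_taut_of_arm_motion {τ m : ℝ} (hτ : 0 < τ) (hτ' : τ ≤ 1 / 2) (hm : 0 < m)
    {a b u a' b' : ℝ → Plane} (hca : ContinuousOn a (Ici 0)) (hcb : ContinuousOn b (Ici 0))
    (ha : ∀ t, 0 ≤ t → HasDerivWithinAt a (a' t) (Ici t) t)
    (hb : ∀ t, 0 ≤ t → HasDerivWithinAt b (b' t) (Ici t) t)
    (hr : ∀ t, 0 ≤ t → ¬ IsFlat (a t) (b t) →
      IsArmVelocity τ m (a t) (b t) (u t) (a' t) (b' t))
    (ha0 : ‖a 0‖ = m) (hb0 : ‖b 0‖ = m) (hab : a 0 ≠ b 0) :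
    ∃ t, 0 ≤ t ∧ t ≤ m / τ + (m / (1 - τ) + m / τ) ∧ a t + b t = 0 ∧ ‖a t‖ = m := by
  have hmotion : ∀ T, (∀ t ∈ Ico 0 T, ¬ IsFlat (a t) (b t)) → IsArmMotion τ m T a b u a' b' :=
    fun T hT => ⟨hca.mono Icc_subset_Ici_self, hcb.mono Icc_subset_Ici_self, hT,
      fun t ht => ha t ht.1, fun t ht => hb t ht.1, fun t ht => hr t ht.1 (hT t ht)⟩
  have h0 : ‖a 0‖ = ‖b 0‖ := ha0.trans hb0.symm
  set S : Set ℝ := Ici 0 ∩ {t | IsFlat (a t) (b t)} with hS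
  have hclosed : IsClosed S := by
    have h1 : ContinuousOn (fun t => inner ℝ (a t) (b t) ^ 2 - ‖a t‖ ^ 2 * ‖b t‖ ^ 2) (Ici 0) :=
      ((hca.inner hcb).pow 2).sub ((hca.norm.pow 2).mul (hcb.norm.pow 2))
    convert h1.preimage_isClosed_of_isClosed isClosed_Ici (isClosed_singleton (x := (0 : ℝ))) using 2
    ext t
    simp [IsFlat, sub_eq_zero]
  have hne : S.Nonempty := by
    by_contra hempty
    -- If the chain were never flat, any horizon beyond the time bound would be admissible; `+ 1`
    -- picks one.
    have h1 := hmotion (m / τ + (m / (1 - τ) + m / τ) + 1) fun t ht hf => hempty ⟨t, ht.1, hf⟩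
    have h2 := (h1.isShape hτ hτ' h0).time_le hτ hτ' hm ha0.le
    linarith
  have hbdd : BddBelow S := ⟨0, fun t ht => ht.1⟩
  obtain ⟨hT0, hTf⟩ := hclosed.csInf_mem hne hbdd
  set T := sInf S
  have hmT := hmotion T fun t ht hf => ht.2.not_ge (csInf_le hbdd ⟨ht.1, hf⟩)
  have hTm : T ∈ Icc 0 T := right_mem_Icc.2 hT0
  have hshape := hmT.isShape hτ hτ' h0
  have hnT := hmT.norm_eq hτ' h0 hTm
  have hsum : a T + b T = 0 := by
    refine (hTf.add_eq_zero_or_eq hnT).resolve_right fun h1 => ?_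
    have h2 := hmT.norm_sub_ge hτ' h0 hTm
    rw [h1, sub_self, norm_zero] at h2
    exact hab (sub_eq_zero.1 (norm_le_zero_iff.1 h2))
  have haT : a T ≠ 0 := by
    intro h1
    have h2 := hmT.norm_sub_ge hτ' h0 hTm
    rw [h1, zero_add] at hsum
    rw [h1, hsum, sub_self, norm_zero] at h2
    exact hab (sub_eq_zero.1 (norm_le_zero_iff.1 h2))
  refine ⟨T, hT0, hshape.time_le hτ hτ' hm ha0.le, hsum, ?_⟩
  rcases (show (0 : ℝ) ≤ T from hT0).eq_or_lt with h1 | h1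
  · rw [← h1, ha0]
  · exact hshape.taut_of_flat hτ' h1 ha0.le (by simp [hsum]) (norm_pos_iff.2 haT)

/-! ### Initial configurations -/

/-- The angle `π` makes one neighbor vector a negative multiple of the other, and unit links force
the factor `-1`. -/
theorem IsContinuousVConfiguration.eq_mid {n : ℕ} {δ : ℝ} {q : ℕ → Plane}
    (h : IsContinuousVConfiguration n δ q) {i : ℕ} (hi : 2 ≤ i) (hi' : i + 1 ≤ n)
    (hne : i ≠ (n + 1) / 2) : q i = mid q i := by
  have h1 := h.1 i hi (by omega)
  have h2 := h.1 (i + 1) (by omega) hi'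
  have h3 := h.2.2 i hi hi' hne
  rw [chainAngle, EuclideanGeometry.angle, InnerProductGeometry.angle_eq_pi_iff] at h3
  obtain ⟨-, r, hr, h4⟩ := h3
  rw [vsub_eq_sub, vsub_eq_sub] at h4
  rw [link] at h1 h2
  rw [Nat.add_sub_cancel, h4, norm_smul, norm_sub_rev, h1, mul_one, Real.norm_of_nonpos hr.le] at h2
  rw [← neg_eq_iff_eq_neg.2 h2.symm] at h4
  rw [mid, sub_eq_iff_eq_add.1 h4, midpoint_eq_smul_add]
  simp only [invOf_eq_inv]
  module

/-- The distance of the ends is the chord `2 m sin(θ/2)`, which the choice of `θ` turns into `2 δ`.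
-/
theorem IsContinuousVConfiguration.arms {m : ℕ} (hm : 1 ≤ m) {δ : ℝ} (hδ : 0 < δ)
    (hδ' : δ ≤ m) {q : ℕ → Plane} (h : IsContinuousVConfiguration (2 * m + 1) δ q) :
    ‖q 1 - q (m + 1)‖ = m ∧ ‖q (2 * m + 1) - q (m + 1)‖ = m ∧
      ‖q 1 - q (2 * m + 1)‖ = 2 * δ ∧ ∀ i, 1 ≤ i → i ≤ 2 * m + 1 →
        q i = twoArms m (q (m + 1)) (q 1 - q (m + 1)) (q (2 * m + 1) - q (m + 1)) i := by
  have hm0 : 0 < (m : ℝ) := by positivity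
  have harms := fun i hi hi' => eq_twoArms (q := q) hm (i := i)
    (fun i hi hi' hne => h.eq_mid hi (by omega) (by omega)) hi hi'
  set a := q 1 - q (m + 1)
  set b := q (2 * m + 1) - q (m + 1)
  have hla : link q (m + 1) = link (twoArms m (q (m + 1)) a b) (m + 1) := by
    rw [link, link, harms _ (by omega) (by omega), harms (m + 1 - 1) (by omega) (by omega)]
    simp [twoArms_middle]
  have hlb : link q (m + 2) = link (twoArms m (q (m + 1)) a b) (m + 2) := by
    rw [link, link, harms _ (by omega) (by omega), harms (m + 2 - 1) (by omega) (by omega)]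
  have ha : ‖a‖ = m := by
    rw [← norm_smul_eq_one_iff hm, ← norm_neg, ← link_twoArms_of_le (by omega) le_rfl, ← hla]
    exact h.1 _ (by omega) (by omega)
  have hb : ‖b‖ = m := by
    rw [← norm_smul_eq_one_iff hm, ← link_twoArms_of_ge le_rfl, ← hlb]
    exact h.1 _ (by omega) (by omega)
  refine ⟨ha, hb, ?_, harms⟩
  have hang : InnerProductGeometry.angle a b = 2 * Real.arcsin (δ / m) := by
    have h1 := h.2.1
    rw [show (2 * m + 1 + 1) / 2 = m + 1 by omega, show (2 * m + 1) / 2 = m by omega] at h1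
    rw [← h1, ← chainAngle_twoArms (x := q (m + 1)) hm, chainAngle, chainAngle,
      harms (m + 1 - 1) (by omega) (by omega), harms (m + 1 + 1) (by omega) (by omega)]
    simp [twoArms_middle]
  have hcos := InnerProductGeometry.cos_angle a b
  rw [hang, Real.cos_two_mul, Real.cos_sq', Real.sin_arcsin
    (by have := div_pos hδ hm0; linarith) ((div_le_one hm0).2 hδ'), ha, hb] at hcos
  refine (sq_eq_sq₀ (norm_nonneg _) (by linarith)).1 ?_
  have hab : q 1 - q (2 * m + 1) = a - b := by simp [a, b]
  rw [hab, norm_sub_sq_real, ha, hb]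
  rw [eq_div_iff (by positivity)] at hcos
  have hc' : inner ℝ a b = m ^ 2 - 2 * δ ^ 2 := by
    rw [← hcos]
    field_simp
    ring
  rw [hc']
  ring

/-! ### Executions of two straight arms -/

theorem isFlatAt_congr {q q' : ℕ → Plane} {n i : ℕ} (h : ∀ j, 1 ≤ j → j ≤ n → q j = q' j)
    (hi : 2 ≤ i) (hi' : i + 1 ≤ n) : IsFlatAt q i ↔ IsFlatAt q' i := by
  rw [IsFlatAt, IsFlatAt, h (i - 1) (by omega) (by omega), h i (by omega) (by omega),
    h (i + 1) (by omega) (by omega)]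

theorem chainAngle_congr {q q' : ℕ → Plane} {n i : ℕ} (h : ∀ j, 1 ≤ j → j ≤ n → q j = q' j)
    (hi : 2 ≤ i) (hi' : i + 1 ≤ n) : chainAngle q i = chainAngle q' i := by
  rw [chainAngle, chainAngle, h (i - 1) (by omega) (by omega), h i (by omega) (by omega),
    h (i + 1) (by omega) (by omega)]

theorem bisectorDir_congr {q q' : ℕ → Plane} {n i : ℕ} (h : ∀ j, 1 ≤ j → j ≤ n → q j = q' j)
    (hi : 2 ≤ i) (hi' : i + 1 ≤ n) : bisectorDir q i = bisectorDir q' i := by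
  rw [bisectorDir, bisectorDir, h (i - 1) (by omega) (by omega), h i (by omega) (by omega),
    h (i + 1) (by omega) (by omega)]

theorem mid_congr {q q' : ℕ → Plane} {n i : ℕ} (h : ∀ j, 1 ≤ j → j ≤ n → q j = q' j)
    (hi : 2 ≤ i) (hi' : i + 1 ≤ n) : mid q i = mid q' i := by
  rw [mid, mid, h (i - 1) (by omega) (by omega), h (i + 1) (by omega) (by omega)]

theorem link_congr {q q' : ℕ → Plane} {n i : ℕ} (h : ∀ j, 1 ≤ j → j ≤ n → q j = q' j)
    (hi : 2 ≤ i) (hi' : i ≤ n) : link q i = link q' i := by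
  rw [link, link, h (i - 1) (by omega) (by omega), h i (by omega) (by omega)]

theorem isMaxChain_congr {q q' : ℕ → Plane} {n : ℕ} (h : ∀ j, 1 ≤ j → j ≤ n → q j = q' j) :
    IsMaxChain n q ↔ IsMaxChain n q' := by
  refine and_congr ?_ ?_
  · exact forall₃_congr fun i hi hi' => by rw [link_congr h hi hi']
  · exact forall₃_congr fun i hi hi' => by
      rw [link_congr h hi (by omega), link_congr h (i := i + 1) (by omega) hi']

theorem move_iff_twoArms {m : ℕ} (hm : 1 ≤ m) {x a b : Plane} (τ : ℝ) :
    (‖link (twoArms m x a b) (m + 1)‖ = 1 ∨ ‖link (twoArms m x a b) (m + 1 + 1)‖ = 1 ∨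
      chainAngle (twoArms m x a b) (m + 1) < psi τ) ↔
    (‖a‖ = m ∨ ‖b‖ = m ∨ InnerProductGeometry.angle a b < psi τ) := by
  rw [link_twoArms_of_le (by omega) le_rfl, link_twoArms_of_ge le_rfl, norm_neg,
    norm_smul_eq_one_iff hm, norm_smul_eq_one_iff hm, chainAngle_twoArms hm]

theorem hasDerivWithinAt_twoArms {m : ℕ} {x a b : ℝ → Plane} {u a' b' : Plane} {s : Set ℝ} {t : ℝ}
    (hx : HasDerivWithinAt x u s t) (ha : HasDerivWithinAt a a' s t)
    (hb : HasDerivWithinAt b b' s t) (i : ℕ) :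
    HasDerivWithinAt (fun t => twoArms m (x t) (a t) (b t) i) (twoArms m u a' b' i) s t := by
  unfold twoArms
  split_ifs
  · exact hx.add (ha.const_smul (((m : ℝ) + 1 - i) / m))
  · exact hx.add (hb.const_smul (((i : ℝ) - (m + 1)) / m))

theorem twoArms_second {m : ℕ} (hm : 1 ≤ m) (x a b : Plane) :
    twoArms m x a b 2 = x + (((m : ℝ) - 1) / m) • a := by
  rw [twoArms_of_le (by omega)]
  push_cast
  congr 3
  ring

theorem twoArms_second_last {m : ℕ} (hm : 1 ≤ m) (x a b : Plane) :
    twoArms m x a b (2 * m) = x + (((m : ℝ) - 1) / m) • b := by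
  rw [twoArms_of_ge (by omega)]
  push_cast
  congr 3
  ring

namespace IsExecution

variable {m : ℕ} {τ : ℝ} {p v : ℕ → ℝ → Plane}

theorem eq_twoArms (h : IsExecution (2 * m + 1) τ p v) (hm : 1 ≤ m)
    (h0 : ∀ i, 2 ≤ i → i ≤ 2 * m → i ≠ m + 1 → p i 0 = mid (p · 0) i) {t : ℝ} (ht : 0 ≤ t)
    {i : ℕ} (hi : 1 ≤ i) (hi' : i ≤ 2 * m + 1) :
    p i t = twoArms m (p (m + 1) t) (p 1 t - p (m + 1) t) (p (2 * m + 1) t - p (m + 1) t) i :=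
  RobotChain.eq_twoArms (q := (p · t)) hm (fun i hi hi' hne =>
    h.inner_stay_mid i hi (by omega) 0 t le_rfl ht (h0 i hi hi' hne)) hi hi'

/-- The positions depend linearly on the three marked robots, and right derivatives are unique. This
supplies the neighbor velocities that enter the outer rule. -/
theorem velocity_eq_twoArms (h : IsExecution (2 * m + 1) τ p v) (hm : 1 ≤ m)
    (h0 : ∀ i, 2 ≤ i → i ≤ 2 * m → i ≠ m + 1 → p i 0 = mid (p · 0) i) {t : ℝ} (ht : 0 ≤ t)
    {i : ℕ} (hi : 1 ≤ i) (hi' : i ≤ 2 * m + 1) :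
    v i t = twoArms m (v (m + 1) t) (v 1 t - v (m + 1) t) (v (2 * m + 1) t - v (m + 1) t) i := by
  have hM := h.hasVelocity (m + 1) (by omega) (by omega) t ht
  have hA := h.hasVelocity 1 (by omega) (by omega) t ht
  have hB := h.hasVelocity (2 * m + 1) (by omega) (by omega) t ht
  have h1 := hasDerivWithinAt_twoArms (m := m) hM (hA.sub hM) (hB.sub hM) i
  have h2 : HasDerivWithinAt (p i) _ (Ici t) t := h1.congr
    (fun s hs => h.eq_twoArms hm h0 (ht.trans hs) hi hi') (h.eq_twoArms hm h0 ht hi hi')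
  exact (uniqueDiffOn_Ici t t self_mem_Ici).eq_deriv _ (h.hasVelocity i hi hi' t ht) h2

theorem isArmVelocity (h : IsExecution (2 * m + 1) τ p v) (hτ' : τ ≤ 1 / 2) (hm : 1 ≤ m)
    (h0 : ∀ i, 2 ≤ i → i ≤ 2 * m → i ≠ m + 1 → p i 0 = mid (p · 0) i) {t : ℝ} (ht : 0 ≤ t)
    (hf : ¬ IsFlat (p 1 t - p (m + 1) t) (p (2 * m + 1) t - p (m + 1) t)) :
    IsArmVelocity τ m (p 1 t - p (m + 1) t) (p (2 * m + 1) t - p (m + 1) t) (v (m + 1) t)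
      (v 1 t - v (m + 1) t) (v (2 * m + 1) t - v (m + 1) t) := by
  have hp := fun i hi hi' => h.eq_twoArms hm h0 ht (i := i) hi hi'
  have hv := fun i hi hi' => h.velocity_eq_twoArms hm h0 ht (i := i) hi hi'
  set a := p 1 t - p (m + 1) t with ha_def
  set b := p (2 * m + 1) t - p (m + 1) t with hb_def
  obtain ⟨ha, hb, -⟩ := ne_zero_of_not_isFlat hf
  have hmid : ¬ IsFlatAt (p · t) (m + 1) := by
    rwa [isFlatAt_congr hp (by omega) (by omega), isFlatAt_twoArms_iff hm]
  have hmove := move_iff_twoArms (x := p (m + 1) t) (a := a) (b := b) hm τ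
  rw [← link_congr hp (by omega) (by omega), ← link_congr hp (by omega) (by omega),
    ← chainAngle_congr hp (by omega) (by omega)] at hmove
  constructor
  · rw [add_sub_cancel]
    refine (eq_outerVelocity_iff hτ' hm (x := p 1 t) (y := p 2 t) (z := v 2 t) ?_ ha ?_).1
      (h.outer_first t ht)
    · rw [hp 2 (by omega) (by omega), ← neg_sub, ← neg_eq_iff_eq_neg.2
        (link_twoArms_of_le (x := p (m + 1) t) (a := a) (b := b) (m := m) le_rfl (by omega)), link,
        ← hp 1 le_rfl (by omega)]
    · rw [hv 2 (by omega) (by omega), twoArms_second hm]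
  · rw [add_sub_cancel]
    refine (eq_outerVelocity_iff hτ' hm (x := p (2 * m + 1) t) (y := p (2 * m) t)
      (z := v (2 * m) t) ?_ hb ?_).1 (h.outer_last t ht)
    · rw [hp (2 * m) (by omega) (by omega),
        ← link_twoArms_of_ge (x := p (m + 1) t) (a := a) (b := b) (m := m) (i := 2 * m + 1)
        (by omega), link, ← hp (2 * m + 1) (by omega) le_rfl, Nat.add_sub_cancel]
    · rw [hv (2 * m) (by omega) (by omega), twoArms_second_last hm]
  · intro hc
    rw [h.inner_move (m + 1) (by omega) (by omega) t ht hmid (hmove.2 hc),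
      bisectorDir_congr hp (by omega) (by omega), bisectorDir_twoArms hm, bisector]
  · intro hc
    exact h.inner_rest (m + 1) (by omega) (by omega) t ht hmid (mt hmove.1 hc)

end IsExecution

theorem exists_isMaxChain_of_isExecutionFrom {m : ℕ} (hm : 1 ≤ m) {τ : ℝ} (hτ : 0 < τ)
    (hτ' : τ ≤ 1 / 2) {δ : ℝ} (hδ : 0 < δ) (hδ' : δ ≤ m) {q : ℕ → Plane}
    (hq : IsContinuousVConfiguration (2 * m + 1) δ q) {p : ℕ → ℝ → Plane}
    (hp : IsExecutionFrom (2 * m + 1) τ q p) :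
    ∃ t : ℝ, 0 ≤ t ∧ t ≤ m / τ + (m / (1 - τ) + m / τ) ∧
      IsMaxChain (2 * m + 1) (fun i => p i t) := by
  obtain ⟨⟨v, h⟩, hpq⟩ := hp
  obtain ⟨ha, hb, hab, -⟩ := hq.arms hm hδ hδ'
  have h0 : ∀ i, 2 ≤ i → i ≤ 2 * m → i ≠ m + 1 → p i 0 = mid (p · 0) i := fun i hi hi' hne => by
    rw [mid_congr (q := (p · 0)) hpq hi (by omega), hpq i (by omega) (by omega)]
    exact hq.eq_mid hi (by omega) (by omega)
  have hM := h.hasVelocity (m + 1) (by omega) (by omega)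
  obtain ⟨t, ht, htle, h1, h2⟩ := exists_taut_of_arm_motion hτ hτ' (m := m) (by positivity)
    (a := fun t => p 1 t - p (m + 1) t) (b := fun t => p (2 * m + 1) t - p (m + 1) t)
    ((h.continuousOn 1 le_rfl (by omega)).sub (h.continuousOn (m + 1) (by omega) (by omega)))
    ((h.continuousOn (2 * m + 1) (by omega) le_rfl).sub
      (h.continuousOn (m + 1) (by omega) (by omega)))
    (fun t ht => (h.hasVelocity 1 le_rfl (by omega) t ht).sub (hM t ht))
    (fun t ht => (h.hasVelocity (2 * m + 1) (by omega) le_rfl t ht).sub (hM t ht))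
    (fun t ht hf => h.isArmVelocity hτ' hm h0 ht hf)
    (by rw [hpq 1 le_rfl (by omega), hpq (m + 1) (by omega) (by omega), ha])
    (by rw [hpq (2 * m + 1) (by omega) le_rfl, hpq (m + 1) (by omega) (by omega), hb])
    (by
      rw [hpq 1 le_rfl (by omega), hpq (m + 1) (by omega) (by omega),
        hpq (2 * m + 1) (by omega) le_rfl, ne_eq, sub_left_inj, ← sub_eq_zero, ← norm_eq_zero, hab]
      positivity)
  refine ⟨t, ht, htle, (isMaxChain_congr fun i hi hi' => h.eq_twoArms hm h0 ht hi hi').2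
    (isMaxChain_twoArms hm h1 h2)⟩

/-! ### Existence of the shape

In the coordinates `(L, η, h)`, the arms have length `L`, the cosine of half of their angle is
`-tanh η`, and `h` is the distance that the middle robot has covered. -/

theorem hasDerivAt_tanh (x : ℝ) : HasDerivAt Real.tanh (1 / Real.cosh x ^ 2) x := by
  have h := (Real.hasDerivAt_sinh x).div (Real.hasDerivAt_cosh x) (Real.cosh_pos x).ne'
  have h1 : Real.tanh = Real.sinh / Real.cosh := by
    ext y; exact Real.tanh_eq_sinh_div_cosh y
  rw [h1]
  refine h.congr_deriv ?_
  rw [← sq, ← sq, Real.cosh_sq_sub_sinh_sq]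

theorem tanh_strictMono : StrictMono Real.tanh :=
  strictMono_of_deriv_pos fun x => by
    rw [(hasDerivAt_tanh x).deriv]
    have := Real.cosh_pos x
    positivity

/-- The right-hand side of the differential equation for the shape of the chain. -/
def shapeField (τ m : ℝ) (z : ℝ × ℝ × ℝ) : ℝ × ℝ × ℝ :=
  -- A flat chain is frozen. This agrees with the strategy because flatness is only reached with
  -- taut arms, where resting outer robots obey their rule.
  if z.2.1 = 0 then 0 else
    (outerSpeed τ m z.1 (middleSpeed τ m z.1 (z.1 * -Real.tanh z.2.1) * -Real.tanh z.2.1)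
        - middleSpeed τ m z.1 (z.1 * -Real.tanh z.2.1) * -Real.tanh z.2.1,
      middleSpeed τ m z.1 (z.1 * -Real.tanh z.2.1) / z.1,
      middleSpeed τ m z.1 (z.1 * -Real.tanh z.2.1))

theorem shapeField_eq {τ m s μ L η h : ℝ} (hη : η ≠ 0)
    (hμ : μ = middleSpeed τ m L (L * -Real.tanh η))
    (hs : s = outerSpeed τ m L (μ * -Real.tanh η)) :
    shapeField τ m (L, η, h) = (s - μ * -Real.tanh η, μ / L, μ) := by
  rw [shapeField, if_neg hη, hs, hμ]

/-- A solution for all times with all the properties that lead to an execution. -/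
structure IsShapeSolution (τ m : ℝ) (z : ℝ → ℝ × ℝ × ℝ) : Prop where
  continuousOn : ContinuousOn z (Ici 0)
  deriv : ∀ t, 0 ≤ t → HasDerivWithinAt z (shapeField τ m (z t)) (Ici t) t
  pos : ∀ t, 0 ≤ t → 0 < (z t).1
  nonpos : ∀ t, 0 ≤ t → (z t).2.1 ≤ 0
  taut : ∀ t, 0 ≤ t → (z t).2.1 = 0 → (z t).1 = m
  stay : ∀ s t, 0 ≤ s → s ≤ t → (z s).2.1 = 0 → (z t).2.1 = 0

/-- Solutions can be concatenated. -/
theorem IsShapeSolution.concat {τ m T : ℝ} (hT : 0 ≤ T) {z y : ℝ → ℝ × ℝ × ℝ}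
    (hy : IsShapeSolution τ m y) (hz : ContinuousOn z (Icc 0 T)) (hzy : z T = y 0)
    (hd : ∀ t ∈ Ico 0 T, HasDerivWithinAt z (shapeField τ m (z t)) (Ici t) t)
    (hpos : ∀ t ∈ Ico 0 T, 0 < (z t).1) (hneg : ∀ t ∈ Ico 0 T, (z t).2.1 < 0) :
    ∃ x, x 0 = z 0 ∧ IsShapeSolution τ m x := by
  set x : ℝ → ℝ × ℝ × ℝ := fun t => if t < T then z t else y (t - T) with hx
  have hlt : ∀ t, t < T → x t = z t := fun t ht => if_pos ht
  have hge : ∀ t, T ≤ t → x t = y (t - T) := fun t ht => if_neg ht.not_gt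
  have hle : ∀ t, t ≤ T → x t = z t := fun t ht => by
    rcases ht.lt_or_eq with h | rfl
    · exact hlt t h
    · rw [hge t le_rfl, sub_self, hzy]
  have hshift : ∀ t, T ≤ t → HasDerivWithinAt x (shapeField τ m (x t)) (Ici t) t := fun t ht => by
    rw [hge t ht]
    have h1 : HasDerivWithinAt (fun t => y (t - T)) (shapeField τ m (y (t - T))) (Ici t) t := by
      have := (hy.deriv (t - T) (sub_nonneg.2 ht)).scomp (h := fun t => t - T) (s := Ici t) t
        ((hasDerivWithinAt_id t _).sub_const T) (fun r hr => sub_le_sub_right hr T)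
      rwa [one_smul] at this
    exact h1.congr (fun r hr => hge r (ht.trans hr)) (hge t ht)
  refine ⟨x, hle 0 hT, ?_, fun t ht => ?_, fun t ht => ?_, fun t ht => ?_, fun t ht h0 => ?_,
    fun s t hs hst h0 => ?_⟩
  · rw [← Icc_union_Ici_eq_Ici hT]
    refine ContinuousOn.union_of_isClosed (hz.congr fun t ht => hle t ht.2) ?_ isClosed_Icc
      isClosed_Ici
    have h1 : MapsTo (fun r => r - T) (Ici T) (Ici 0) := fun r hr => sub_nonneg.2 (mem_Ici.1 hr)
    exact (hy.continuousOn.comp (continuous_sub_right T).continuousOn h1).congr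
      fun r hr => hge r hr
  · rcases lt_or_ge t T with h | h
    · rw [hlt t h]
      refine (hd t ⟨ht, h⟩).congr_of_eventuallyEq ?_ (hlt t h)
      filter_upwards [mem_nhdsWithin_of_mem_nhds (Iio_mem_nhds h)] with r hr using hlt r hr
    · exact hshift t h
  · rcases lt_or_ge t T with h | h
    · rw [hlt t h]; exact hpos t ⟨ht, h⟩
    · rw [hge t h]; exact hy.pos _ (sub_nonneg.2 h)
  · rcases lt_or_ge t T with h | h
    · rw [hlt t h]; exact (hneg t ⟨ht, h⟩).le
    · rw [hge t h]; exact hy.nonpos _ (sub_nonneg.2 h)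
  · rcases lt_or_ge t T with h | h
    -- Flatness is impossible on the first piece, so only the second piece is concerned; the same
    -- holds for `stay`.
    · rw [hlt t h] at h0; exact absurd h0 (hneg t ⟨ht, h⟩).ne
    · rw [hge t h] at h0 ⊢; exact hy.taut _ (sub_nonneg.2 h) h0
  · rcases lt_or_ge s T with h | h
    · rw [hlt s h] at h0; exact absurd h0 (hneg s ⟨hs, h⟩).ne
    · rw [hge s h] at h0
      rw [hge t (h.trans hst)]
      exact hy.stay _ _ (sub_nonneg.2 h) (sub_le_sub_right hst T) h0

theorem isShapeSolution_const {τ m h : ℝ} (hm : 0 < m) :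
    IsShapeSolution τ m fun _ => (m, 0, h) where
  continuousOn := continuousOn_const
  deriv t _ := by
    rw [shapeField, if_pos rfl]
    exact hasDerivWithinAt_const _ _ _
  pos _ _ := hm
  nonpos _ _ := le_rfl
  taut _ _ _ := rfl
  stay _ _ _ _ _ := rfl

theorem tanh_neg_of_neg {η : ℝ} (h : η < 0) : 0 < -Real.tanh η := by
  have := tanh_strictMono h
  rw [Real.tanh_zero] at this
  linarith

/-- The evolution of a taut chain with a large angle. -/
theorem exists_solution_of_taut {τ m η h : ℝ} (hm : 0 < m) (hη : η ≤ 0)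
    (hκ : -Real.tanh η ≤ 1 - τ) : ∃ z, z 0 = (m, η, h) ∧ IsShapeSolution τ m z := by
  -- With `L = m` and unit middle speed, `η' = 1 / m`, so `η` reaches zero at time `m * -η`; the
  -- chain is frozen from then on.
  have hT : 0 ≤ m * -η := mul_nonneg hm.le (neg_nonneg.2 hη)
  have hd : ∀ t, HasDerivAt (fun t : ℝ => ((m, η + t / m, h + t) : ℝ × ℝ × ℝ)) (0, 1 / m, 1) t :=
    fun t => (hasDerivAt_const t m).prodMk
      ((((hasDerivAt_id t).div_const m).const_add η).prodMk ((hasDerivAt_id t).const_add h))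
  have hneg : ∀ t ∈ Ico 0 (m * -η), η + t / m < 0 := fun t ht => by
    have := (div_lt_iff₀' hm).2 ht.2
    linarith
  obtain ⟨x, hx, hx'⟩ := (isShapeSolution_const (τ := τ) (h := h + m * -η) hm).concat hT
    (z := fun t => (m, η + t / m, h + t)) (fun t _ => (hd t).continuousAt.continuousWithinAt)
    (by rw [mul_div_cancel_left₀ _ hm.ne', add_neg_cancel]) (fun t ht => by
      have h1 := hneg t ht
      have h2 := tanh_neg_of_neg h1
      have h3 : -Real.tanh (η + t / m) ≤ 1 - τ := by
        have := tanh_strictMono.monotone (show η ≤ η + t / m by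
          have := div_nonneg ht.1 hm.le
          linarith)
        linarith
      rw [shapeField_eq (μ := 1) (s := -Real.tanh (η + t / m)) h1.ne (if_pos (Or.inl rfl)).symm
        (by rw [outerSpeed, if_neg (lt_irrefl _), one_mul, min_eq_right h3, max_eq_right h2.le])]
      rw [one_mul, sub_self]
      exact (hd t).hasDerivWithinAt) (fun _ _ => hm) hneg
  exact ⟨x, by simpa using hx, hx'⟩

/-- The evolution of a chain with critical angle. -/
theorem exists_solution_of_critical {τ m L η h : ℝ} (hτ' : τ ≤ 1 / 2) (hL : 0 < L) (hLm : L ≤ m)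
    (hη : η < 0) (hκ : -Real.tanh η = 1 - τ) :
    ∃ z, z 0 = (L, η, h) ∧ IsShapeSolution τ m z := by
  have h1 : 0 < 1 - τ := by linarith
  obtain ⟨y, hy, hy'⟩ := exists_solution_of_taut (h := h) (hL.trans_le hLm) hη.le hκ.le
  -- At the critical angle the middle robot rests until the arms, growing at rate `1 - τ`, are taut.
  have hT : 0 ≤ (m - L) / (1 - τ) := div_nonneg (sub_nonneg.2 hLm) h1.le
  have hd : ∀ t, HasDerivAt (fun t : ℝ => ((L + (1 - τ) * t, η, h) : ℝ × ℝ × ℝ)) (1 - τ, 0, 0) t :=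
    fun t => by
      have := ((hasDerivAt_id t).const_mul (1 - τ)).const_add L
      rw [mul_one] at this
      exact this.prodMk (hasDerivAt_const t (η, h))
  have hpos : ∀ t ∈ Ico 0 ((m - L) / (1 - τ)), 0 < L + (1 - τ) * t := fun t ht => by
    have := mul_nonneg h1.le ht.1
    linarith
  obtain ⟨x, hx, hx'⟩ := hy'.concat hT (z := fun t => (L + (1 - τ) * t, η, h))
    (fun t _ => (hd t).continuousAt.continuousWithinAt)
    (by rw [hy, mul_div_cancel₀ _ h1.ne', add_sub_cancel]) (fun t ht => by
      have h2 : L + (1 - τ) * t < m := by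
        have := (lt_div_iff₀' h1).1 ht.2
        linarith
      have h3 := hpos t ht
      rw [shapeField_eq (μ := 0) (s := 1 - τ) hη.ne (by
          rw [middleSpeed, mul_div_cancel_left₀ _ h3.ne', hκ, if_neg]
          simp [h2.ne]) (by rw [outerSpeed, if_pos h2]), zero_mul, sub_zero, zero_div]
      exact (hd t).hasDerivWithinAt) hpos (fun _ _ => hη)
  exact ⟨x, by simpa using hx, hx'⟩

/-- The time at which a chain with a small angle has the parameter `x`, up to a constant. -/
theorem exists_time_change {τ : ℝ} (hτ : 0 < τ) (hτ' : τ ≤ 1 / 2) {C : ℝ} (hC : 0 < C) :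
    ∃ g y : ℝ → ℝ, StrictMono g ∧ (∀ x, y (g x) = x) ∧ StrictMono y ∧
      ∀ t, HasDerivAt y (C * Real.exp ((1 - τ) * y t) * Real.cosh (y t))⁻¹ t := by
  -- An antiderivative of `C exp((1 - τ) x) cosh x`, with the cosine split into exponentials. Its
  -- inverse `y` solves the differential equation; the limits at both ends make `g` surjective.
  set g : ℝ → ℝ := fun x =>
    C / 2 * (Real.exp ((2 - τ) * x) / (2 - τ) + -(Real.exp (-(τ * x)) / τ)) with hg
  have h2 : (0 : ℝ) < 2 - τ := by linarith
  have hd : ∀ x, HasDerivAt g (C * Real.exp ((1 - τ) * x) * Real.cosh x) x := fun x => by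
    have e1 := ((((hasDerivAt_id x).const_mul (2 - τ)).exp).div_const (2 - τ))
    have e2 := (((((hasDerivAt_id x).const_mul τ).neg).exp).div_const τ).neg
    refine ((e1.add e2).const_mul (C / 2)).congr_deriv ?_
    have e3 : Real.exp ((2 - τ) * x) = Real.exp ((1 - τ) * x) * Real.exp x := by
      rw [← Real.exp_add]; congr 1; ring
    have e4 : Real.exp (-(τ * x)) = Real.exp ((1 - τ) * x) * Real.exp (-x) := by
      rw [← Real.exp_add]; congr 1; ring
    simp only [id, Pi.neg_apply]
    rw [Real.cosh_eq, e3, e4]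
    field_simp
  have hmono : StrictMono g := strictMono_of_deriv_pos fun x => by
    rw [(hd x).deriv]
    have := Real.cosh_pos x
    positivity
  have hcont : Continuous g := continuous_iff_continuousAt.2 fun x => (hd x).continuousAt
  have hC2 : 0 < C / 2 := by positivity
  have t1 : Filter.Tendsto (fun x : ℝ => Real.exp (τ * x) / τ) Filter.atTop Filter.atTop :=
    (Real.tendsto_exp_atTop.comp (Filter.tendsto_id.const_mul_atTop hτ)).atTop_div_const hτ
  have t2 : Filter.Tendsto (fun x : ℝ => Real.exp ((2 - τ) * x) / (2 - τ)) Filter.atTop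
      Filter.atTop :=
    (Real.tendsto_exp_atTop.comp (Filter.tendsto_id.const_mul_atTop h2)).atTop_div_const h2
  have htop : Filter.Tendsto g Filter.atTop Filter.atTop := by
    refine Filter.Tendsto.const_mul_atTop hC2 (Filter.tendsto_atTop_add_right_of_le' _ (-(1 / τ))
      t2 ?_)
    filter_upwards [Filter.eventually_ge_atTop 0] with x hx
    have : Real.exp (-(τ * x)) ≤ 1 := Real.exp_le_one_iff.2 (by
      have := mul_nonneg hτ.le hx
      linarith)
    exact neg_le_neg (div_le_div_of_nonneg_right this hτ.le)
  have hbot : Filter.Tendsto g Filter.atBot Filter.atBot := by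
    refine Filter.Tendsto.const_mul_atBot hC2 (Filter.tendsto_atBot_add_left_of_ge' _ (1 / (2 - τ))
      ?_ ?_)
    · filter_upwards [Filter.eventually_le_atBot 0] with x hx
      exact div_le_div_of_nonneg_right (Real.exp_le_one_iff.2
        (mul_nonpos_of_nonneg_of_nonpos h2.le hx)) h2.le
    · refine Filter.tendsto_neg_atTop_atBot.comp ?_
      refine (t1.comp Filter.tendsto_neg_atBot_atTop).congr fun x => ?_
      simp
  have hsurj : Function.Surjective g := hcont.surjective htop hbot
  set e := hmono.orderIsoOfSurjective g hsurj with he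
  have hge : ∀ t, g (e.symm t) = t := fun t => e.apply_symm_apply t
  refine ⟨g, e.symm, hmono, fun x => e.symm_apply_apply x, e.symm.strictMono, fun t => ?_⟩
  refine HasDerivAt.of_local_left_inverse e.symm.continuous.continuousAt (hd _) ?_
    (Filter.Eventually.of_forall hge)
  have := Real.cosh_pos (e.symm t)
  positivity

/-- The evolution of a chain with a small angle. -/
theorem exists_solution_of_small_angle {τ m L η h : ℝ} (hτ : 0 < τ) (hτ' : τ ≤ 1 / 2) (hL : 0 < L)
    (hLm : L ≤ m) (hκ : 1 - τ < -Real.tanh η) :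
    ∃ z, z 0 = (L, η, h) ∧ IsShapeSolution τ m z := by
  obtain ⟨η₁, hη₁⟩ : ∃ η₁, -Real.tanh η₁ = 1 - τ := by
    refine ⟨Real.artanh (-(1 - τ)), ?_⟩
    rw [Real.tanh_artanh ⟨by linarith, by linarith⟩, neg_neg]
  have hη₁0 : η₁ < 0 := by
    refine tanh_strictMono.lt_iff_lt.1 ?_
    rw [Real.tanh_zero]
    linarith
  have hlt : η < η₁ := tanh_strictMono.lt_iff_lt.1 (by linarith)
  -- At unit middle speed and outer speed `1 - τ`, `dL/dη = L (1 - τ + tanh η)`. Hence `L` is a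
  -- multiple of `exp((1 - τ) η) cosh η`, and `C` fits the initial length.
  set C := L / (Real.exp ((1 - τ) * η) * Real.cosh η) with hC_def
  have hcosh := Real.cosh_pos
  have hC : 0 < C := by have := hcosh η; positivity
  obtain ⟨g, y, hg, hyg, hy, hd⟩ := exists_time_change hτ hτ' hC
  set ℓ : ℝ → ℝ := fun x => C * Real.exp ((1 - τ) * x) * Real.cosh x with hℓ
  have hℓpos : ∀ x, 0 < ℓ x := fun x => by have := hcosh x; simp only [hℓ]; positivity
  have hℓd : ∀ x, HasDerivAt ℓ (ℓ x * ((1 - τ) - -Real.tanh x)) x := fun x => by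
    have e1 := ((((hasDerivAt_id x).const_mul (1 - τ)).exp).const_mul C).mul (Real.hasDerivAt_cosh x)
    refine e1.congr_deriv ?_
    simp only [hℓ, id]
    rw [Real.tanh_eq_sinh_div_cosh]
    have := (hcosh x).ne'
    field_simp
    ring
  have hℓ0 : ℓ η = L := by
    simp only [hℓ, hC_def]
    have := (hcosh η).ne'
    field_simp
  -- The arms shrink as long as `-tanh` exceeds `1 - τ`, that is, up to the critical parameter `η₁`.
  have hℓ1 : ℓ η₁ ≤ m := by
    refine le_trans ?_ (hℓ0.le.trans hLm)
    refine le_of_right_deriv_nonpos hlt.le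
      (fun x _ => (hℓd x).continuousAt.continuousWithinAt)
      (fun x _ => (hℓd x).hasDerivWithinAt) fun x hx => ?_
    have := tanh_strictMono hx.2
    exact mul_nonpos_of_nonneg_of_nonpos (hℓpos x).le (by linarith)
  set T := g η₁ - g η with hT_def
  have hT : 0 ≤ T := sub_nonneg.2 (hg.monotone hlt.le)
  obtain ⟨w, hw, hw'⟩ := exists_solution_of_critical (m := m) (h := h + T) hτ' (hℓpos η₁) hℓ1
    hη₁0 hη₁
  have hyT : y (g η + T) = η₁ := by rw [hT_def, add_sub_cancel, hyg]
  have hdy : ∀ t, HasDerivAt (fun t => y (g η + t)) (ℓ (y (g η + t)))⁻¹ t := fun t =>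
    (hd (g η + t)).comp_const_add (g η) t
  have hdz : ∀ t, HasDerivAt
      (fun t : ℝ => ((ℓ (y (g η + t)), y (g η + t), h + t) : ℝ × ℝ × ℝ))
      ((1 - τ) - -Real.tanh (y (g η + t)), 1 / ℓ (y (g η + t)), 1) t := fun t => by
    refine HasDerivAt.prodMk ?_ (HasDerivAt.prodMk ?_ ((hasDerivAt_id t).const_add h))
    · refine ((hℓd _).comp t (hdy t)).congr_deriv ?_
      have := (hℓpos (y (g η + t))).ne'
      field_simp
    · rw [one_div]
      exact hdy t
  have hylt : ∀ t ∈ Ico 0 T, y (g η + t) < η₁ := fun t ht => by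
    rw [← hyT]
    exact hy (by linarith [ht.2])
  obtain ⟨x, hx, hx'⟩ := hw'.concat hT (z := fun t => (ℓ (y (g η + t)), y (g η + t), h + t))
    (fun t _ => (hdz t).continuousAt.continuousWithinAt)
    (by rw [hw, hyT]) (fun t ht => by
      have h1 := hylt t ht
      have h2 := tanh_strictMono h1
      have h3 : 1 - τ < -Real.tanh (y (g η + t)) := by linarith
      -- Both branches of `outerSpeed` give `1 - τ`, because the approach speed exceeds it; so taut
      -- arms need no separate treatment.
      rw [shapeField_eq (μ := 1) (s := 1 - τ) (h1.trans hη₁0).ne (by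
          rw [middleSpeed, mul_div_cancel_left₀ _ (hℓpos _).ne', if_pos (Or.inr h3)]) (by
          rw [outerSpeed, one_mul, min_eq_left h3.le, max_eq_right (by linarith), ite_self]),
        one_mul]
      exact (hdz t).hasDerivWithinAt) (fun t _ => hℓpos _)
      (fun t ht => (hylt t ht).trans hη₁0)
  exact ⟨x, by rw [hx, add_zero, hyg, hℓ0, add_zero], hx'⟩

theorem exists_shape_solution {τ m η : ℝ} (hτ : 0 < τ) (hτ' : τ ≤ 1 / 2) (hm : 0 < m)
    (hη : η ≤ 0) (h : ℝ) : ∃ z, z 0 = (m, η, h) ∧ IsShapeSolution τ m z := by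
  rcases le_or_gt (-Real.tanh η) (1 - τ) with h1 | h1
  · exact exists_solution_of_taut hm hη h1
  · exact exists_solution_of_small_angle hτ hτ' hm le_rfl h1

/-! ### Existence of executions -/

section Frame

variable {e f : Plane}

theorem norm_sq_frame (he : ‖e‖ = 1) (hf : ‖f‖ = 1) (hef : inner ℝ e f = 0) (c d : ℝ) :
    ‖c • e + d • f‖ ^ 2 = c ^ 2 + d ^ 2 := by
  rw [norm_add_sq_real, inner_smul_left, inner_smul_right, hef, norm_smul, norm_smul, he, hf]
  simp

theorem inner_frame (he : ‖e‖ = 1) (hef : inner ℝ e f = 0) (c d : ℝ) :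
    inner ℝ e (c • e + d • f) = c := by
  rw [inner_add_right, inner_smul_right, inner_smul_right, hef, real_inner_self_eq_norm_sq, he]
  simp

end Frame

/-- The unit vector with components `-tanh η` and `r / cosh η`, where `r = ± 1`. -/
def armDir (e f : Plane) (r η : ℝ) : Plane :=
  (-Real.tanh η) • e + (r * (Real.cosh η)⁻¹) • f

section armDir

variable {e f : Plane}

theorem tanh_sq_add (η : ℝ) : Real.tanh η ^ 2 + (Real.cosh η)⁻¹ ^ 2 = 1 := by
  have := (Real.cosh_pos η).ne'
  rw [Real.tanh_eq_sinh_div_cosh]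
  field_simp
  rw [Real.cosh_sq]

theorem norm_armDir (he : ‖e‖ = 1) (hf : ‖f‖ = 1) (hef : inner ℝ e f = 0) {r : ℝ}
    (hr : r ^ 2 = 1) (η : ℝ) : ‖armDir e f r η‖ = 1 := by
  rw [← sq_eq_sq₀ (norm_nonneg _) zero_le_one, armDir, norm_sq_frame he hf hef, mul_pow, hr,
    one_mul, neg_sq, tanh_sq_add, one_pow]

theorem norm_smul_armDir (he : ‖e‖ = 1) (hf : ‖f‖ = 1) (hef : inner ℝ e f = 0) {r : ℝ}
    (hr : r ^ 2 = 1) {L : ℝ} (hL : 0 < L) (η : ℝ) : ‖L • armDir e f r η‖ = L := by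
  rw [norm_smul, norm_armDir he hf hef hr, mul_one, Real.norm_of_nonneg hL.le]

theorem normalize_smul_armDir (he : ‖e‖ = 1) (hf : ‖f‖ = 1) (hef : inner ℝ e f = 0) {r : ℝ}
    (hr : r ^ 2 = 1) {L : ℝ} (hL : 0 < L) (η : ℝ) :
    NormedSpace.normalize (L • armDir e f r η) = armDir e f r η := by
  rw [NormedSpace.normalize_smul_of_pos hL,
    NormedSpace.normalize_eq_self_of_norm_eq_one (norm_armDir he hf hef hr η)]

theorem armDir_add (L η : ℝ) :
    L • armDir e f 1 η + L • armDir e f (-1) η = (2 * (L * -Real.tanh η)) • e := by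
  rw [armDir, armDir]
  module

theorem hasDerivWithinAt_armDir {η : ℝ → ℝ} {η' : ℝ} {s : Set ℝ} {t r : ℝ}
    (h : HasDerivWithinAt η η' s t) :
    HasDerivWithinAt (fun t => armDir e f r (η t))
      (η' • (-((Real.cosh (η t))⁻¹ ^ 2) • e +
        (r * (-Real.tanh (η t) * (Real.cosh (η t))⁻¹)) • f)) s t := by
  have h1 := ((hasDerivAt_tanh (η t)).comp_hasDerivWithinAt t h).neg.smul_const e
  have h2 := ((((Real.hasDerivAt_cosh (η t)).inv (Real.cosh_pos _).ne').comp_hasDerivWithinAt t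
    h).const_mul r).smul_const f
  refine (h1.add h2).congr_deriv ?_
  rw [smul_add, smul_smul, smul_smul, Real.tanh_eq_sinh_div_cosh]
  have := (Real.cosh_pos (η t)).ne'
  congr 2
  · field_simp
  · field_simp

/-- The velocity of the end of an arm relative to the middle robot, in terms of the shape. -/
def armVelocity (e f : Plane) (r : ℝ) (z z' : ℝ × ℝ × ℝ) : Plane :=
  z'.1 • armDir e f r z.2.1 + z.1 • z'.2.1 • (-((Real.cosh z.2.1)⁻¹ ^ 2) • e +
    (r * (-Real.tanh z.2.1 * (Real.cosh z.2.1)⁻¹)) • f)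

theorem hasDerivWithinAt_arm {z : ℝ → ℝ × ℝ × ℝ} {z' : ℝ × ℝ × ℝ} {s : Set ℝ} {t : ℝ} (r : ℝ)
    (h : HasDerivWithinAt z z' s t) :
    HasDerivWithinAt (fun t => (z t).1 • armDir e f r (z t).2.1) (armVelocity e f r (z t) z')
      s t := by
  have h1 : HasDerivWithinAt (fun t => (z t).1) z'.1 s t :=
    (ContinuousLinearMap.fst ℝ ℝ (ℝ × ℝ)).hasFDerivAt.comp_hasDerivWithinAt t h
  have h2 : HasDerivWithinAt (fun t => (z t).2.1) z'.2.1 s t :=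
    ((ContinuousLinearMap.fst ℝ ℝ ℝ).comp
      (ContinuousLinearMap.snd ℝ ℝ (ℝ × ℝ))).hasFDerivAt.comp_hasDerivWithinAt t h
  refine (h1.smul (hasDerivWithinAt_armDir h2)).congr_deriv ?_
  rw [armVelocity, add_comm]

/-- Treats flat and bent chains together. The last clause is the geometric point: rotating the arm
at rate `μ / L` exactly cancels the component of `μ • e` transverse to it, so the end moves along
its arm. -/
theorem exists_speeds {τ m L η h : ℝ} (hτ' : τ ≤ 1 / 2) (hL : 0 < L) (hη : η = 0 → L = m) :
    ∃ s μ : ℝ, 0 ≤ s ∧ s ≤ 1 - τ ∧ 0 ≤ μ ∧ μ ≤ 1 ∧ (shapeField τ m (L, η, h)).2.2 = μ ∧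
      s = outerSpeed τ m L (μ * -Real.tanh η) ∧
      (η ≠ 0 → μ = middleSpeed τ m L (L * -Real.tanh η)) ∧
      ∀ (e f : Plane) (r : ℝ),
        μ • e + armVelocity e f r (L, η, h) (shapeField τ m (L, η, h)) = s • armDir e f r η := by
  rcases eq_or_ne η 0 with rfl | hne
  · have h0 : shapeField τ m (L, 0, h) = 0 := if_pos rfl
    refine ⟨0, 0, le_rfl, by linarith, le_rfl, zero_le_one, by rw [h0]; rfl, ?_, fun h1 =>
      absurd rfl h1, fun e f r => ?_⟩
    -- Tautness is essential here: at the end of a slack arm the outer robot would have to move with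
    -- speed `1 - τ`.
    · rw [hη rfl, outerSpeed, if_neg (lt_irrefl _), zero_mul,
        min_eq_right (by linarith), max_self]
    · rw [h0, armVelocity]
      simp
  · set μ := middleSpeed τ m L (L * -Real.tanh η) with hμ
    set s := outerSpeed τ m L (μ * -Real.tanh η) with hs
    refine ⟨s, μ, outerSpeed_nonneg hτ' _ _ _, outerSpeed_le hτ' _ _ _, middleSpeed_nonneg _ _ _ _,
      middleSpeed_le_one _ _ _ _, ?_, rfl, fun _ => rfl, fun e f r => ?_⟩
    · rw [shapeField_eq hne hμ hs]
    · rw [shapeField_eq hne hμ hs, armVelocity]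
      dsimp only
      have h1 : L • (μ / L) • (-((Real.cosh η)⁻¹ ^ 2) • e +
          (r * (-Real.tanh η * (Real.cosh η)⁻¹)) • f) = μ • ((Real.tanh η ^ 2 - 1) • e +
          (r * (-Real.tanh η * (Real.cosh η)⁻¹)) • f) := by
        rw [smul_smul, mul_div_cancel₀ _ hL.ne']
        congr 3
        linarith [tanh_sq_add η]
      rw [h1, armDir]
      module

theorem isFlat_arms_iff (he : ‖e‖ = 1) (hf : ‖f‖ = 1) (hef : inner ℝ e f = 0) {L η : ℝ}
    (hL : 0 < L) : IsFlat (L • armDir e f 1 η) (L • armDir e f (-1) η) ↔ η = 0 := by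
  have he0 : e ≠ 0 := fun h => by simp [h] at he
  have hf0 : f ≠ 0 := fun h => by simp [h] at hf
  constructor
  · intro h
    rcases h.add_eq_zero_or_eq (by rw [norm_smul_armDir he hf hef (by norm_num) hL,
      norm_smul_armDir he hf hef (by norm_num) hL]) with h1 | h1
    · rw [armDir_add] at h1
      refine tanh_strictMono.injective ?_
      rw [Real.tanh_zero]
      simpa [he0, hL.ne'] using h1
    · exfalso
      rw [smul_right_inj hL.ne', armDir, armDir, add_right_inj, smul_left_inj hf0] at h1
      have := inv_pos.2 (Real.cosh_pos η)
      linarith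
  · rintro rfl
    refine isFlat_of_add_eq_zero ?_
    rw [armDir_add]
    simp

theorem isArmVelocity_arms {τ m : ℝ} (hτ : 0 < τ) (hτ' : τ ≤ 1 / 2) (he : ‖e‖ = 1) (hf : ‖f‖ = 1)
    (hef : inner ℝ e f = 0) {L η s μ : ℝ} {a' b' : Plane} (hL : 0 < L) (hη : η < 0)
    (hs : s = outerSpeed τ m L (μ * -Real.tanh η))
    (hμ : μ = middleSpeed τ m L (L * -Real.tanh η))
    (ha : μ • e + a' = s • armDir e f 1 η) (hb : μ • e + b' = s • armDir e f (-1) η) :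
    IsArmVelocity τ m (L • armDir e f 1 η) (L • armDir e f (-1) η) (μ • e) a' b' := by
  have hκ := tanh_neg_of_neg hη
  have hna := norm_smul_armDir he hf hef (r := 1) (by norm_num) hL η
  have hnb := norm_smul_armDir he hf hef (r := -1) (by norm_num) hL η
  have ha0 : L • armDir e f 1 η ≠ 0 := fun h => by
    rw [h, norm_zero] at hna
    exact hL.ne hna
  have hsum : ‖L • armDir e f 1 η + L • armDir e f (-1) η‖ / 2 / ‖L • armDir e f 1 η‖
      = -Real.tanh η := by
    rw [hna, armDir_add, norm_smul, he, mul_one, Real.norm_of_nonneg (by positivity),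
      mul_div_cancel_left₀ _ two_ne_zero, mul_div_cancel_left₀ _ hL.ne']
  have hdir : ∀ r, inner ℝ (μ • e) (armDir e f r η) = μ * -Real.tanh η := fun r => by
    rw [inner_smul_left, armDir, inner_frame he hef, conj_trivial]
  have hmv : (‖L • armDir e f 1 η‖ = m ∨ ‖L • armDir e f (-1) η‖ = m ∨
      InnerProductGeometry.angle (L • armDir e f 1 η) (L • armDir e f (-1) η) < psi τ) ↔
      (L = m ∨ 1 - τ < L * -Real.tanh η / L) := by
    rw [angle_lt_psi_iff hτ hτ' ha0 (hna.trans hnb.symm), hsum, hna, hnb, or_self_left,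
      mul_div_cancel_left₀ _ hL.ne']
  refine ⟨?_, ?_, fun hc => ?_, fun hc => ?_⟩
  · rw [hna, normalize_smul_armDir he hf hef (by norm_num) hL, hdir, ← hs, ha]
  · rw [hnb, normalize_smul_armDir he hf hef (by norm_num) hL, hdir, ← hs, hb]
  · rw [bisector_eq_of_norm_eq ha0 (hna.trans hnb.symm), armDir_add,
      NormedSpace.normalize_smul_of_pos (by positivity),
      NormedSpace.normalize_eq_self_of_norm_eq_one he, hμ, middleSpeed, if_pos (hmv.1 hc), one_smul]
  · rw [hμ, middleSpeed, if_neg (mt hmv.2 hc), zero_smul]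

end armDir

/-- Each velocity is a convex combination of the velocities at the two ends of its arm. -/
theorem norm_twoArms_le {m : ℕ} (hm : 1 ≤ m) {u a b : Plane} (hu : ‖u‖ ≤ 1) (ha : ‖u + a‖ ≤ 1)
    (hb : ‖u + b‖ ≤ 1) {i : ℕ} (hi : 1 ≤ i) (hi' : i ≤ 2 * m + 1) :
    ‖twoArms m u a b i‖ ≤ 1 := by
  have hm0 : 0 < (m : ℝ) := by positivity
  have key : ∀ (c : ℝ) (w : Plane), 0 ≤ c → c ≤ 1 → ‖u + w‖ ≤ 1 → ‖u + c • w‖ ≤ 1 := by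
    intro c w hc hc' hw
    rw [show u + c • w = (1 - c) • u + c • (u + w) by module]
    refine (norm_add_le _ _).trans ?_
    rw [norm_smul, norm_smul, Real.norm_of_nonneg hc, Real.norm_of_nonneg (sub_nonneg.2 hc')]
    nlinarith
  have hi1 : (1 : ℝ) ≤ i := by exact_mod_cast hi
  have hi2 : (i : ℝ) ≤ 2 * m + 1 := by exact_mod_cast hi'
  rcases le_or_gt i (m + 1) with h | h
  · have h1 : (i : ℝ) ≤ m + 1 := by exact_mod_cast h
    rw [twoArms_of_le h]
    exact key _ _ (div_nonneg (by linarith) hm0.le) ((div_le_one hm0).2 (by linarith)) ha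
  · have h1 : (m : ℝ) + 1 ≤ i := by exact_mod_cast h.le
    rw [twoArms_of_ge h.le]
    exact key _ _ (div_nonneg (by linarith) hm0.le) ((div_le_one hm0).2 (by linarith)) hb

theorem exists_isExecution {m : ℕ} (hm : 1 ≤ m) {τ : ℝ} (hτ : 0 < τ) (hτ' : τ ≤ 1 / 2)
    (x : Plane) {e f : Plane} (he : ‖e‖ = 1) (hf : ‖f‖ = 1) (hef : inner ℝ e f = 0) {η₀ : ℝ}
    (hη₀ : η₀ ≤ 0) :
    ∃ p v, IsExecution (2 * m + 1) τ p v ∧ ∀ i, p i 0 =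
      twoArms m x ((m : ℝ) • armDir e f 1 η₀) ((m : ℝ) • armDir e f (-1) η₀) i := by
  obtain ⟨z, hz0, hz⟩ := exists_shape_solution hτ hτ' (m := m) (by positivity) hη₀ 0
  set a : ℝ → Plane := fun t => (z t).1 • armDir e f 1 (z t).2.1
  set b : ℝ → Plane := fun t => (z t).1 • armDir e f (-1) (z t).2.1
  set y : ℝ → Plane := fun t => x + (z t).2.2 • e
  set a' : ℝ → Plane := fun t => armVelocity e f 1 (z t) (shapeField τ m (z t))
  set b' : ℝ → Plane := fun t => armVelocity e f (-1) (z t) (shapeField τ m (z t))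
  set u : ℝ → Plane := fun t => (shapeField τ m (z t)).2.2 • e
  have hy : ∀ t, 0 ≤ t → HasDerivWithinAt y (u t) (Ici t) t := fun t ht => by
    have h2 : HasDerivWithinAt (fun t => (z t).2.2) (shapeField τ m (z t)).2.2 (Ici t) t :=
      ((ContinuousLinearMap.snd ℝ ℝ ℝ).comp
        (ContinuousLinearMap.snd ℝ ℝ (ℝ × ℝ))).hasFDerivAt.comp_hasDerivWithinAt t (hz.deriv t ht)
    exact (h2.smul_const e).const_add x
  have hspeeds := fun t ht => exists_speeds (h := (z t).2.2) hτ' (hz.pos t ht) (hz.taut t ht)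
  have hflat : ∀ t, 0 ≤ t → (IsFlatAt (twoArms m (y t) (a t) (b t)) (m + 1) ↔ (z t).2.1 = 0) :=
    fun t ht => by rw [isFlatAt_twoArms_iff hm, isFlat_arms_iff he hf hef (hz.pos t ht)]
  have hsum : ∀ t, 0 ≤ t → (a t + b t = 0 ↔ (z t).2.1 = 0) := fun t ht => by
    rw [← isFlat_arms_iff he hf hef (hz.pos t ht)]
    refine ⟨isFlat_of_add_eq_zero, fun h => ?_⟩
    rw [isFlat_arms_iff he hf hef (hz.pos t ht)] at h
    simp only [a, b]
    rw [armDir_add, h]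
    simp
  have hrule : ∀ t, 0 ≤ t → (z t).2.1 ≠ 0 →
      IsArmVelocity τ m (a t) (b t) (u t) (a' t) (b' t) := fun t ht h => by
    obtain ⟨s, μ, -, -, -, -, h1, h2, h3, h4⟩ := hspeeds t ht
    have hu : u t = μ • e := congrArg (· • e) h1
    rw [hu]
    exact isArmVelocity_arms hτ hτ' he hf hef (hz.pos t ht) ((hz.nonpos t ht).lt_of_ne h) h2 (h3 h)
      (h4 e f 1) (h4 e f (-1))
  have hcont : ∀ r, ContinuousOn (fun t => (z t).1 • armDir e f r (z t).2.1) (Ici 0) := fun r => by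
    have hc := hz.continuousOn
    unfold armDir
    have h1 : Continuous Real.tanh := continuous_iff_continuousAt.2 fun x =>
      (hasDerivAt_tanh x).continuousAt
    have h2 : ContinuousOn (fun t => Real.tanh (z t).2.1) (Ici 0) :=
      h1.comp_continuousOn hc.snd.fst
    have h3 : ContinuousOn (fun t => (Real.cosh (z t).2.1)⁻¹) (Ici 0) :=
      (Real.continuous_cosh.comp_continuousOn hc.snd.fst).inv₀ fun t _ => (Real.cosh_pos _).ne'
    exact hc.fst.smul ((h2.neg.smul continuousOn_const).add
      ((continuousOn_const.mul h3).smul continuousOn_const))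
  have hne : ∀ r, r ^ 2 = 1 → ∀ t, 0 ≤ t → (z t).1 • armDir e f r (z t).2.1 ≠ 0 :=
    fun r hr t ht h => by
      have := norm_smul_armDir he hf hef hr (hz.pos t ht) (z t).2.1
      rw [h, norm_zero] at this
      exact (hz.pos t ht).ne this
  have houter : ∀ r, r ^ 2 = 1 → ∀ t, 0 ≤ t →
      u t + armVelocity e f r (z t) (shapeField τ m (z t)) =
        outerSpeed τ m ‖(z t).1 • armDir e f r (z t).2.1‖
          (inner ℝ (u t) (NormedSpace.normalize ((z t).1 • armDir e f r (z t).2.1))) •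
        NormedSpace.normalize ((z t).1 • armDir e f r (z t).2.1) := fun r hr t ht => by
    obtain ⟨s, μ, -, -, -, -, h1, h2, h3, h4⟩ := hspeeds t ht
    have hu : u t = μ • e := congrArg (· • e) h1
    have h5 := h4 e f r
    rw [← hu] at h5
    rw [norm_smul_armDir he hf hef hr (hz.pos t ht),
      normalize_smul_armDir he hf hef hr (hz.pos t ht)]
    refine h5.trans ?_
    rw [hu, inner_smul_left, armDir, inner_frame he hef, conj_trivial, ← h2]
  refine ⟨fun i t => twoArms m (y t) (a t) (b t) i, fun i t => twoArms m (u t) (a' t) (b' t) i,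
    ?_, fun i => ?_⟩
  swap
  · simp only [y, a, b, hz0, zero_smul, add_zero]
  constructor
  · intro i _ _
    have hyc : ContinuousOn y (Ici 0) :=
      continuousOn_const.add (hz.continuousOn.snd.snd.smul continuousOn_const)
    rcases le_or_gt i (m + 1) with h | h
    · simp only [twoArms_of_le h]
      exact hyc.add ((hcont 1).const_smul (((m : ℝ) + 1 - i) / m))
    · simp only [twoArms_of_ge h.le]
      exact hyc.add ((hcont (-1)).const_smul (((i : ℝ) - (m + 1)) / m))
  · intro i _ _ t ht
    exact hasDerivWithinAt_twoArms (hy t ht) (hasDerivWithinAt_arm 1 (hz.deriv t ht))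
      (hasDerivWithinAt_arm (-1) (hz.deriv t ht)) i
  · intro i hi hi' t ht
    obtain ⟨s, μ, hs0, hs1, hμ0, hμ1, h1, h2, h3, h4⟩ := hspeeds t ht
    have hu : u t = μ • e := congrArg (· • e) h1
    have h5 : ∀ r, r ^ 2 = 1 → ‖u t + armVelocity e f r (z t) (shapeField τ m (z t))‖ ≤ 1 :=
      fun r hr => by
        have h6 := h4 e f r
        rw [← hu] at h6
        refine (congrArg norm h6).trans_le ?_
        rw [norm_smul, norm_armDir he hf hef hr, Real.norm_of_nonneg hs0]
        linarith
    refine norm_twoArms_le hm ?_ (h5 1 (by norm_num)) (h5 (-1) (by norm_num)) hi hi'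
    rw [hu, norm_smul, he, Real.norm_of_nonneg hμ0]
    linarith
  · intro t ht
    refine (eq_outerVelocity_iff hτ' hm (a := a t) (u := u t) ?_ (hne 1 (by norm_num) t ht)
      ?_).2 ?_
    · rw [← neg_sub, ← neg_eq_iff_eq_neg.2 (link_twoArms_of_le (x := y t) (a := a t) (b := b t)
        (m := m) le_rfl (by omega)), link]
    · rw [twoArms_second hm, twoArms_first hm, add_sub_cancel_left]
    · rw [twoArms_first hm]
      exact houter 1 (by norm_num) t ht
  · intro t ht
    refine (eq_outerVelocity_iff hτ' hm (a := b t) (u := u t) ?_ (hne (-1) (by norm_num) t ht)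
      ?_).2 ?_
    · exact link_twoArms_of_ge (i := 2 * m + 1) (by omega)
    · rw [Nat.add_sub_cancel, twoArms_second_last hm, twoArms_last hm, add_sub_cancel_left]
    · rw [twoArms_last hm]
      exact houter (-1) (by norm_num) t ht
  · intro i hi hi' t ht hf' hc
    obtain rfl : i = m + 1 := by
      by_contra h
      exact hf' (isFlatAt_twoArms_of_ne hi h)
    exact twoArms_middle.trans (((hrule t ht (mt (hflat t ht).2 hf')).move
      ((move_iff_twoArms hm τ).1 hc)).trans (bisectorDir_twoArms hm).symm)
  · intro i hi hi' t ht hf' hc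
    obtain rfl : i = m + 1 := by
      by_contra h
      exact hf' (isFlatAt_twoArms_of_ne hi h)
    exact twoArms_middle.trans ((hrule t ht (mt (hflat t ht).2 hf')).rest
      (mt (move_iff_twoArms hm τ).2 hc))
  · intro i hi hi' s t hs hst h
    rcases eq_or_ne i (m + 1) with rfl | hi0
    · exact (hflat t (hs.trans hst)).2 (hz.stay s t hs hst ((hflat s hs).1 h))
    · exact isFlatAt_twoArms_of_ne hi hi0
  · intro i hi hi' t ht h hmid
    -- Every collinear robot of this chain is already on its midpoint, so this rule is vacuous.
    exfalso
    rcases eq_or_ne i (m + 1) with rfl | hi0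
    · exact hmid ((middle_eq_mid_twoArms_iff hm).2 ((hsum t ht).2 ((hflat t ht).1 h)))
    · exact hmid (twoArms_eq_mid hi hi0)
  · intro i hi hi' s t hs hst h
    rcases eq_or_ne i (m + 1) with rfl | hi0
    · exact (middle_eq_mid_twoArms_iff hm).2 ((hsum t (hs.trans hst)).2
        (hz.stay s t hs hst ((hsum s hs).1 ((middle_eq_mid_twoArms_iff hm).1 h))))
    · exact twoArms_eq_mid hi hi0

/-- Two vectors of equal length in terms of an orthonormal basis along their bisectors. -/
theorem exists_frame {a b : Plane} {δ : ℝ} (hδ : 0 < δ) (hab : ‖a‖ = ‖b‖)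
    (h : ‖a - b‖ = 2 * δ) :
    ∃ (e f : Plane) (H : ℝ), ‖e‖ = 1 ∧ ‖f‖ = 1 ∧ inner ℝ e f = 0 ∧ 0 ≤ H ∧
      a = H • e + δ • f ∧ b = H • e + (-δ) • f := by
  set f : Plane := (2 * δ)⁻¹ • (a - b) with hf_def
  have hf : ‖f‖ = 1 := by
    rw [hf_def, norm_smul, h, norm_inv, Real.norm_of_nonneg (by positivity),
      inv_mul_cancel₀ (by positivity)]
  have hfd : δ • f = (1 / 2 : ℝ) • (a - b) := by
    rw [hf_def, smul_smul]
    congr 1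
    field_simp
  have hperp : inner ℝ (a + b) (a - b) = 0 := by
    rw [inner_add_left, inner_sub_right, inner_sub_right, real_inner_self_eq_norm_sq,
      real_inner_self_eq_norm_sq, real_inner_comm a b, hab]
    ring
  obtain ⟨e, H, he, hH, hef, hs⟩ : ∃ (e : Plane) (H : ℝ), ‖e‖ = 1 ∧ 0 ≤ H ∧ inner ℝ e f = 0 ∧
      H • e = (1 / 2 : ℝ) • (a + b) := by
    by_cases h0 : a + b = 0
    -- When `δ = m` the chain starts flat and has no bisector; a quarter turn of `f` serves as `e`.
    · refine ⟨!₂[-f 1, f 0], 0, ?_, le_rfl, ?_, by simp [h0]⟩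
      · rw [← hf, EuclideanSpace.norm_eq, EuclideanSpace.norm_eq]
        simp [Fin.sum_univ_two, add_comm]
      · simp [PiLp.inner_apply, Fin.sum_univ_two]
        ring
    · refine ⟨NormedSpace.normalize (a + b), ‖a + b‖ / 2, NormedSpace.norm_normalize h0,
        by positivity, ?_, ?_⟩
      · rw [hf_def, NormedSpace.normalize, inner_smul_left, inner_smul_right, hperp]
        simp
      · rw [div_eq_inv_mul, mul_smul, NormedSpace.norm_smul_normalize, one_div]
  refine ⟨e, f, H, he, hf, hef, hH, ?_, ?_⟩
  · rw [hs, hfd]; module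
  · rw [hs, neg_smul, hfd]; module

theorem exists_isExecutionFrom {m : ℕ} (hm : 1 ≤ m) {τ : ℝ} (hτ : 0 < τ) (hτ' : τ ≤ 1 / 2)
    {δ : ℝ} (hδ : 0 < δ) (hδ' : δ ≤ m) {q : ℕ → Plane}
    (hq : IsContinuousVConfiguration (2 * m + 1) δ q) :
    ∃ p, IsExecutionFrom (2 * m + 1) τ q p := by
  obtain ⟨ha, hb, hab, harms⟩ := hq.arms hm hδ hδ'
  obtain ⟨e, f, H, he, hf, hef, hH, h1, h2⟩ := exists_frame hδ (ha.trans hb.symm)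
    (by rw [sub_sub_sub_cancel_right, hab])
  have hm0 : 0 < (m : ℝ) := by positivity
  have hsq : (m : ℝ) ^ 2 = H ^ 2 + δ ^ 2 := by
    rw [← ha, h1, norm_sq_frame he hf hef]
  -- The initial parameter solves `-sinh η₀ = H / δ`, hence `cosh η₀ = m / δ` and `-tanh η₀ = H /
  -- m`.
  have hsqrt : Real.sqrt (1 + (H / δ) ^ 2) = m / δ := by
    rw [Real.sqrt_eq_iff_mul_self_eq_of_pos (by positivity)]
    field_simp
    linarith
  have hdir : ∀ r : ℝ, (m : ℝ) • armDir e f r (-Real.arsinh (H / δ)) = H • e + (r * δ) • f := by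
    intro r
    rw [armDir, Real.tanh_neg, neg_neg, Real.tanh_arsinh, Real.cosh_neg, Real.cosh_arsinh, hsqrt,
      smul_add, smul_smul, smul_smul]
    congr 2
    · field_simp
    · field_simp
  obtain ⟨p, v, hpv, hp⟩ := exists_isExecution hm hτ hτ' (q (m + 1)) he hf hef
    (η₀ := -Real.arsinh (H / δ)) (neg_nonpos.2 (Real.arsinh_nonneg_iff.2 (by positivity)))
  refine ⟨p, ⟨v, hpv⟩, fun i hi hi' => ?_⟩
  rw [hp i, harms i hi hi', hdir, hdir, one_mul, neg_one_mul, ← h1, ← h2]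

end

end RobotChain

/-! ### Conclusion for odd `n` -/

theorem mainTheorem10 (n : ℕ) (hn : Odd n) (τ : ℝ) (hτ : 0 < τ) (hτ' : τ ≤ 1 / 2)
    (δ : ℝ) (hδ : 0 < δ) (hδ' : δ ≤ ((n / 2 : ℕ) : ℝ))
    (q : ℕ → Plane) (hq : RobotChain.IsContinuousVConfiguration n δ q) :
    (∃ p, RobotChain.IsExecutionFrom n τ q p) ∧
      ∀ p, RobotChain.IsExecutionFrom n τ q p →
        ∃ t : ℝ, 0 ≤ t ∧ t ≤ (n : ℝ) * (1 / τ + 1 / (1 - τ)) ∧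
          RobotChain.IsMaxChain n (fun i => p i t) := by
  obtain ⟨m, rfl⟩ := hn
  rw [show (2 * m + 1) / 2 = m by omega] at hδ'
  have hm : 1 ≤ m := by
    have : (0 : ℝ) < m := hδ.trans_le hδ'
    exact_mod_cast this
  refine ⟨RobotChain.exists_isExecutionFrom hm hτ hτ' hδ hδ' hq, fun p hp => ?_⟩
  obtain ⟨t, ht, htle, hmax⟩ :=
    RobotChain.exists_isMaxChain_of_isExecutionFrom hm hτ hτ' hδ hδ' hq hp
  -- What remains is `2m/τ + m/(1 - τ) ≤ (2m + 1)(1/τ + 1/(1 - τ))`.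
  refine ⟨t, ht, htle.trans ?_, hmax⟩
  have h1 : 0 < 1 / τ := by positivity
  have h2 : 0 < 1 / (1 - τ) := one_div_pos.2 (by linarith)
  have hm0 : (0 : ℝ) ≤ m := by positivity
  rw [div_eq_mul_one_div, div_eq_mul_one_div (m : ℝ) (1 - τ)]
  push_cast
  nlinarith [mul_nonneg hm0 h2.le]
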